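/- **Setting.** For each sample size $n$ let $p=p_n\ge 1$ and observe $x_{il}=\eta_l(\boldsymbol\alpha_i)+u_{il}$, $1\le i\le n$, $1\le l\le p$, where $\boldsymbol\alpha_i\in\mathbb R^r$ ($r\ge1$) are random latent variables, $\eta_l:\mathbb R^r\to\mathbb R$ are random latent functions, and all these objects may depend on $n$. Let $\mathscr F=\mathscr F_n$ be the $\sigma$-field generated by $(\boldsymbol\alpha_i)_{i\le n}$ and $(\eta_l)_{l\le p}$, and assume $\mathbb E[u_{il}|\mathscr F]=0$. Let $\mathcal R^\dagger\subseteq\{1,\dots,p\}$ with $p^\dagger=|\mathcal R^\dagger|\asymp p$. Write $\boldsymbol\eta^\dagger=(\eta_l)_{l\in\mathcal R^\dagger}$, $\mathbf{H}^\dagger(\boldsymbol\alpha)=\boldsymbol\eta^\dagger(\boldsymbol\alpha)$, $\mathbf{H}^\dagger_{\cdot i}=\boldsymbol\eta^\dagger(\boldsymbol\alpha_i)$, $\mathbf{X}^\dagger_{\cdot i}=(x_{il})_{l\in\mathcal R^\dagger}$, and let $\rho$ be the pseudo-max distance: for vectors $\mathbf{v}_1,\dots,\mathbf{v}_n\in\mathbb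 R^{p^\dagger}$, $\rho(\mathbf{v}_i,\mathbf{v}_j)=\max_{l\ne i,j}\frac1{p^\dagger}|(\mathbf{v}_i-\mathbf{v}_j)'\mathbf{v}_l|$. For random sequences, $X_n\lesssim_{\mathbb P}Y_n$ means $\lim_{\varepsilon\to\infty}\limsup_n\mathbb P(|X_n/Y_n|\ge\varepsilon)=0$, and $X_n\gtrsim_{\mathbb P}Y_n$ means $Y_n\lesssim_{\mathbb P}X_n$. **Regularity.** Let $\nu>0$ and let $\bar m\ge2$ be an integer. (a) For each $n$, $\boldsymbol\alpha_1,\dots,\boldsymbol\alpha_n$ are i.i.d. with compact convex support $\mathcal A$ (the same for all $n$) and a Lebesgue density on $\mathcal A$ that is bounded and bounded away from zero, uniformly in $n$. (b) Almost surely each $\eta_l$ is $\bar m$ times continuously differentiable on $\mathcal A$, with all partial derivatives of order at most $\bar m$ bounded on $\mathcal A$ by a universal constant (derivatives on the boundary are taken within $\mathcal A$). (c) The $u_{il}$ are independent over $i$ and $l$ conditional on $\mathscr F$, and $\sup_n\max_{i\le n,\,l\le p_n}\mathbb E[|u_{il}|^{2+\nu}|\mathscr F]<\infty$ almost surely. **Theorem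 (Pseudo-max distance).** Under these regularity conditions, suppose moreover that: (i) for every $\varepsilon>0$, $\displaystyle\lim_{\Delta\downarrow0}\limsup_{n\to\infty}\mathbb P\Big\{\max_{i\le n}\ \max_{j:\rho(\mathbf{H}^\dagger_{\cdot i},\mathbf{H}^\dagger_{\cdot j})<\Delta}\|\boldsymbol\alpha_i-\boldsymbol\alpha_j\|>\varepsilon\Big\}=0$; (ii) for some $\underline c>0$, $\displaystyle\lim_{n\to\infty}\mathbb P\Big\{\min_{i\le n}s_{\min}\Big(\tfrac1{p^\dagger}\nabla\boldsymbol\eta^\dagger(\boldsymbol\alpha_i)'\,\nabla\boldsymbol\eta^\dagger(\boldsymbol\alpha_i)\Big)\ge\underline c\Big\}=1$, where $\nabla\boldsymbol\eta^\dagger$ is the $p^\dagger\times r$ Jacobian matrix and $s_{\min}$ the smallest singular value; (iii) (non-collapsing) for some $\underline c'>0$, with probability tending to one, for every $i\le n$ the column space of $\nabla\boldsymbol\eta^\dagger(\boldsymbol\alpha_i)$ is $r$-dimensional and has an orthonormal basis $\mathbf{e}_1,\dots,\mathbf{e}_r$ such that $\displaystyle\sup_{\boldsymbol\alpha\in\mathcal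 A}\tfrac1{p^\dagger}\|\mathscr P_{\mathbf{e}_\ell}[\mathbf{H}^\dagger(\boldsymbol\alpha)]\|^2\ge\underline c'$ for all $\ell\le r$, where $\mathscr P_{\mathbf{e}}$ is the orthogonal projection onto the line spanned by $\mathbf{e}$; (iv) $\displaystyle\frac{n^{4/\nu}(\log n)^{(\nu-2)/\nu}}{p}\lesssim1$. Then, with $a_n=((\log n)/p)^{1/2}$, one has $a_n>0$ for all large $n$, $a_n\to0$, and $$\max_{1\le i,j\le n}\big|\rho(\mathbf{X}^\dagger_{\cdot i},\mathbf{X}^\dagger_{\cdot j})-\rho(\mathbf{H}^\dagger_{\cdot i},\mathbf{H}^\dagger_{\cdot j})\big|\lesssim_{\mathbb P}a_n,$$ $$\max_{\boldsymbol\alpha_i\neq\boldsymbol\alpha_j}\frac{\rho(\mathbf{H}^\dagger_{\cdot i},\mathbf{H}^\dagger_{\cdot j})}{\|\boldsymbol\alpha_i-\boldsymbol\alpha_j\|}\lesssim_{\mathbb P}1,\qquad \min_{\boldsymbol\alpha_i\neq\boldsymbol\alpha_j}\frac{\rho(\mathbf{H}^\dagger_{\cdot i},\mathbf{H}^\dagger_{\cdot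 j})}{\|\boldsymbol\alpha_i-\boldsymbol\alpha_j\|}\gtrsim_{\mathbb P}1,$$ that is, the indirect matching assumption holds with $a_n=((\log n)/p)^{1/2}$, $\rho_0=0$ and $\underline\varsigma=\bar\varsigma=1$. -/

import Mathlib

open MeasureTheory ProbabilityTheory Filter Topology
open scoped ENNReal

noncomputable section

/-- The pseudo-max distance between the `i`-th and the `j`-th member of a family of vectors
`v 1, …, v n` indexed by `ι`:  `max_{l ≠ i, j} |(v i - v j)' v l| / |ι|`. -/
def pseudoMaxDist (n : ℕ) (ι : Type) [Fintype ι] (v : Fin n → EuclideanSpace ℝ ι)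
    (i j : Fin n) : ℝ :=
  ⨆ l : {l : Fin n // l ≠ i ∧ l ≠ j}, |inner ℝ (v i - v j) (v l)| / (Fintype.card ι : ℝ)

/-- The smallest singular value of an `r × r` matrix (singular values are numbered from `0`
in descending order). -/
def sMin {r : ℕ} (G : Matrix (Fin r) (Fin r) ℝ) : ℝ :=
  (Matrix.toEuclideanLin G).singularValues (r - 1)

section Stochastic

variable {Ω : Type*} [MeasurableSpace Ω]

/-- `X n ≲_P Y n`:  `limsup_{ε → ∞} limsup_n P(|X n / Y n| ≥ ε) = 0`. The event is written
`ε |Y n| ≤ |X n|`, so that `X n / Y n` counts as infinite where `Y n` vanishes. -/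
def StochLE (μ : Measure Ω) (X Y : ℕ → Ω → ℝ) : Prop :=
  limsup (fun ε : ℝ => limsup (fun n : ℕ => μ {ω | ε * |Y n ω| ≤ |X n ω|}) atTop) atTop = 0

/-- The events `E n` have probability tending to one (the probability of the complement
tends to zero). -/
def ProbTendsToOne (μ : Measure Ω) (E : ℕ → Set Ω) : Prop :=
  Tendsto (fun n => μ (E n)ᶜ) atTop (𝓝 0)

/-- Conditional independence, given the `σ`-field `m`, of a family of real random variables:
`P(⋂ i ∈ S, {f i ∈ B i} | m) = ∏ i ∈ S, P(f i ∈ B i | m)` a.s. for all finite `S` and Borel `B`.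
(Mathlib's `iCondIndepFun` is the same notion, on standard Borel sample spaces only.) -/
def CondIndepFamily {ι : Type*} (μ : Measure Ω) (m : MeasurableSpace Ω) (f : ι → Ω → ℝ) : Prop :=
  ∀ (S : Finset ι) (B : ι → Set ℝ), (∀ i ∈ S, MeasurableSet (B i)) →
    (μ⟦⋂ i ∈ S, f i ⁻¹' B i | m⟧) =ᵐ[μ] ∏ i ∈ S, (μ⟦f i ⁻¹' B i | m⟧)

end Stochastic

/-- The random ingredients, for every sample size `n`, of a nonlinear factor model with `r` latent
variables: the number `p n` of features, the set `R n` of the features (rows) used for matching,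
the latent variables `α n i`, the (random) latent functions `η n l ω : ℝ^r → ℝ`, and the errors
`u n i l`. -/
structure FactorModel (Ω : Type*) [MeasurableSpace Ω] (r : ℕ) where
  p : ℕ → ℕ
  p_pos : ∀ n, 0 < p n
  R : ∀ n, Finset (Fin (p n))
  α : ∀ n, Fin n → Ω → EuclideanSpace ℝ (Fin r)
  η : ∀ n, Fin (p n) → Ω → EuclideanSpace ℝ (Fin r) → ℝ
  u : ∀ n, Fin n → Fin (p n) → Ω → ℝ
  measurable_α : ∀ n i, Measurable (α n i)
  measurable_η : ∀ n l x, Measurable (fun ω => η n l ω x)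
  measurable_u : ∀ n i l, Measurable (u n i l)

namespace FactorModel

variable {Ω : Type*} [mΩ : MeasurableSpace Ω] {r : ℕ} (M : FactorModel Ω r)

/-- The `σ`-field generated by the latent variables and the latent functions. -/
abbrev F (n : ℕ) : MeasurableSpace Ω :=
  (⨆ i, MeasurableSpace.comap (M.α n i) inferInstance) ⊔
    ⨆ l, ⨆ x, MeasurableSpace.comap (fun ω => M.η n l ω x) inferInstance

theorem F_le (n : ℕ) : M.F n ≤ mΩ :=
  sup_le (iSup_le fun i => (M.measurable_α n i).comap_le)
    (iSup_le fun l => iSup_le fun x => (M.measurable_η n l x).comap_le)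

/-- The number of features used for matching. -/
def pR (n : ℕ) : ℝ := (M.R n).card

/-- The vector `(η_l(x))` of the latent functions with index in `R n`, at the point `x`. -/
def etaR (n : ℕ) (ω : Ω) (x : EuclideanSpace ℝ (Fin r)) : EuclideanSpace ℝ (M.R n) :=
  WithLp.toLp 2 fun l => M.η n l ω x

/-- The `i`-th column of the noise-free matrix, rows in `R n`. -/
def H (n : ℕ) (ω : Ω) (i : Fin n) : EuclideanSpace ℝ (M.R n) :=
  M.etaR n ω (M.α n i ω)

/-- The `i`-th column of the data matrix, rows in `R n`: `x_{il} = η_l(α_i) + u_{il}`. -/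
def X (n : ℕ) (ω : Ω) (i : Fin n) : EuclideanSpace ℝ (M.R n) :=
  WithLp.toLp 2 fun l => M.η n l ω (M.α n i ω) + M.u n i l ω

/-- The Jacobian matrix at `x` of the latent functions with index in `R n`; derivatives are
taken within the support `A`. -/
def jacobian (A : Set (EuclideanSpace ℝ (Fin r))) (n : ℕ) (ω : Ω)
    (x : EuclideanSpace ℝ (Fin r)) : Matrix (M.R n) (Fin r) ℝ :=
  Matrix.of fun l j => fderivWithin ℝ (M.η n l ω) A x (EuclideanSpace.single j 1)

/-- The linear subspace spanned by the columns of the Jacobian matrix at `x`. -/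
def tangentSpace (A : Set (EuclideanSpace ℝ (Fin r))) (n : ℕ) (ω : Ω)
    (x : EuclideanSpace ℝ (Fin r)) : Submodule ℝ (EuclideanSpace ℝ (M.R n)) :=
  Submodule.span ℝ (Set.range fun j : Fin r => WithLp.toLp 2 fun l => M.jacobian A n ω x l j)

/-- The standing regularity conditions, with compact convex support `A`, smoothness `m` and
moment exponent `2 + ν`. -/
structure Regularity (μ : Measure Ω) (A : Set (EuclideanSpace ℝ (Fin r))) (m : ℕ) (ν : ℝ) :
    Prop where
  isCompact : IsCompact A
  convex : Convex ℝ A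
  /-- The latent variables of each sample are independent. -/
  indep : ∀ n, iIndepFun (M.α n) μ
  /-- They have a common law, with support `A` and a density there that is bounded and bounded
  away from zero. -/
  density : ∃ c C : ℝ, 0 < c ∧ ∀ n, ∃ f : EuclideanSpace ℝ (Fin r) → ℝ, Measurable f ∧
    (∀ x ∈ A, c ≤ f x ∧ f x ≤ C) ∧
    ∀ i, μ.map (M.α n i) = (volume.restrict A).withDensity fun x => ENNReal.ofReal (f x)
  two_le : 2 ≤ m
  /-- The latent functions are `m` times continuously differentiable on `A`, and their derivatives
  of order at most `m` are bounded by a universal constant. -/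
  smooth : ∃ C : ℝ, ∀ n, ∀ᵐ ω ∂μ, ∀ l, ContDiffOn ℝ m (M.η n l ω) A ∧
    ∀ k ≤ m, ∀ x ∈ A, ‖iteratedFDerivWithin ℝ k (M.η n l ω) A x‖ ≤ C
  /-- The errors are independent over `i` and `l` conditional on the `σ`-field `F`. -/
  condIndep : ∀ n, CondIndepFamily μ (M.F n) fun q : Fin n × Fin (M.p n) => M.u n q.1 q.2
  integrable_u : ∀ n i l, Integrable (M.u n i l) μ
  condMean : ∀ n i l, μ[M.u n i l | M.F n] =ᵐ[μ] 0
  ν_pos : 0 < ν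
  /-- The conditional moments of order `2 + ν` are almost surely bounded, over all `i`, `l`
  and all sample sizes. -/
  moment : ∀ᵐ ω ∂μ, (⨆ n, ⨆ i, ⨆ l,
    condLExp (M.F n) μ (fun ω' => ENNReal.ofReal (|M.u n i l ω'| ^ (2 + ν))) ω) < ∞

/-- Identification: the distance `ρ` of the noise-free structure reveals the differences of the
latent variables. -/
def Identified (μ : Measure Ω) (ρ : ∀ (n : ℕ) (ι : Type) [Fintype ι],
    (Fin n → EuclideanSpace ℝ ι) → Fin n → Fin n → ℝ) : Prop :=
  ∀ ε > (0 : ℝ), Tendsto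
    (fun Δ : ℝ => limsup (fun n => μ {ω | ∃ i j : Fin n,
      ρ n (M.R n) (M.H n ω) i j < Δ ∧ ε < ‖M.α n i ω - M.α n j ω‖}) atTop)
    (𝓝[>] 0) (𝓝 0)

/-- With probability tending to one, the smallest singular values of the scaled Gram matrices of
the Jacobian at the data points are bounded away from zero. -/
def JacobianNondegenerate (μ : Measure Ω) (A : Set (EuclideanSpace ℝ (Fin r))) : Prop :=
  ∃ c > (0 : ℝ), ProbTendsToOne μ fun n => {ω | ∀ i : Fin n,
    c ≤ sMin ((1 / M.pR n) •
      ((M.jacobian A n ω (M.α n i ω)).transpose * M.jacobian A n ω (M.α n i ω)))}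

/-- Non-collapsing: with probability tending to one, at every data point, the tangent space has an
orthonormal basis of `r` vectors such that the projection of the latent surface onto each of these
directions does not degenerate. -/
def NonCollapsing (μ : Measure Ω) (A : Set (EuclideanSpace ℝ (Fin r))) : Prop :=
  ∃ c > (0 : ℝ), ProbTendsToOne μ fun n => {ω | ∀ i : Fin n,
    ∃ b : OrthonormalBasis (Fin r) ℝ (M.tangentSpace A n ω (M.α n i ω)), ∀ k : Fin r,
      c ≤ ⨆ x : A, (1 / M.pR n) *
        ‖(Submodule.span ℝ {(b k : EuclideanSpace ℝ (M.R n))}).starProjection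
          (M.etaR n ω x)‖ ^ 2}

/-- The indirect matching conditions for the distance `ρ`, with denoising error `a n`, shift `ρ₀`,
lower exponent `s` and upper exponent `t`. -/
structure IndirectMatching (μ : Measure Ω) (ρ : ∀ (n : ℕ) (ι : Type) [Fintype ι],
    (Fin n → EuclideanSpace ℝ ι) → Fin n → Fin n → ℝ) (a : ℕ → ℝ) (ρ₀ s t : ℝ) : Prop where
  shift_nonneg : 0 ≤ ρ₀
  lower_pos : 0 < s
  upper_pos : 0 < t
  a_pos : ∀ᶠ n in atTop, 0 < a n
  a_tendsto : Tendsto a atTop (𝓝 0)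
  /-- `max_{i,j} |ρ(X_i, X_j) - ρ(H_i, H_j) - ρ₀| ≲_P a_n`. -/
  denoising : StochLE μ
    (fun n ω => ⨆ q : Fin n × Fin n,
      |ρ n (M.R n) (M.X n ω) q.1 q.2 - ρ n (M.R n) (M.H n ω) q.1 q.2 - ρ₀|)
    (fun n _ => a n)
  /-- `max_{α_i ≠ α_j} ρ(H_i, H_j) / ‖α_i - α_j‖ ^ t ≲_P 1`. -/
  upper : StochLE μ
    (fun n ω => ⨆ q : {q : Fin n × Fin n // M.α n q.1 ω ≠ M.α n q.2 ω},
      ρ n (M.R n) (M.H n ω) q.1.1 q.1.2 / ‖M.α n q.1.1 ω - M.α n q.1.2 ω‖ ^ t)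
    (fun _ _ => 1)
  /-- `1 ≲_P min_{α_i ≠ α_j} ρ(H_i, H_j) / ‖α_i - α_j‖ ^ s`. -/
  lower : StochLE μ
    (fun _ _ => 1)
    (fun n ω => ⨅ q : {q : Fin n × Fin n // M.α n q.1 ω ≠ M.α n q.2 ω},
      ρ n (M.R n) (M.H n ω) q.1.1 q.1.2 / ‖M.α n q.1.1 ω - M.α n q.1.2 ω‖ ^ s)

end FactorModel

end

/-!
Conditionally on the latent variables and functions the errors are independent and centred, with
bounded moments of order `2 + ν`. The difference of the two pseudo-max distances is controlled by
sums over the features of products of errors with one another and of errors with latent values.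
Such sums obey a Fuk–Nagaev inequality; truncating at `√(p log n)`, the rate condition is what
makes the union bound over the `n²` pairs go through at deviations of order `√(p log n)`, that is,
`a_n` after division by the number of features. The almost sure bound on the conditional moments is
not uniform in the outcome, so the inequality is applied on an event of probability close to one.

Scaled by the square root of the number of features, the latent functions trace a surface `g` with
bounded derivatives, and `ρ(H_i, H_j)` is the maximum over `l ≠ i, j` of
`|⟨g (α_i) - g (α_j), g (α_l)⟩|`; the upper bound is the Cauchy–Schwarz inequality. For the lower
bound at nearby points let `d = α_i - α_j` and let `D` be the derivative of `g` at `α_j`. By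
nondegeneracy of the Jacobian there is `w` in the support with `⟨D d, D (w - α_j)⟩` of order `‖d‖`.
Moving from `α_j` a small but fixed proportion `t` of the way to `w`, the inner product of `D d`
with `g` changes by an amount of order `t ‖d‖`, up to a curvature error of order `t² ‖d‖`, so it is
of order `‖d‖` at an endpoint `z` of this step. The latent sample fills the support, hence some
`α_l` is close enough to `z` to inherit the bound. Pairs of distant points are handled by
identification.
-/

/-! ### Functions with bounded second derivatives -/

section BoundedC2On

variable {E F : Type*} [NormedAddCommGroup E] [NormedSpace ℝ E] [NormedAddCommGroup F]
  [NormedSpace ℝ F] {A : Set E} {C : ℝ} {f : E → F} {x y : E}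

/-- The function `f` is twice continuously differentiable on `A`, and is bounded by `C` there
together with its first two derivatives. -/
structure BoundedC2On (A : Set E) (C : ℝ) (f : E → F) : Prop where
  contDiffOn : ContDiffOn ℝ 2 f A
  norm_iteratedFDerivWithin_le :
    ∀ k ≤ 2, ∀ x ∈ A, ‖iteratedFDerivWithin ℝ k f A x‖ ≤ C

namespace BoundedC2On

theorem mono {C' : ℝ} (hf : BoundedC2On A C f) (h : C ≤ C') : BoundedC2On A C' f where
  contDiffOn := hf.contDiffOn
  norm_iteratedFDerivWithin_le k hk x hx := (hf.norm_iteratedFDerivWithin_le k hk x hx).trans h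

theorem norm_le (hf : BoundedC2On A C f) (hx : x ∈ A) : ‖f x‖ ≤ C := by
  simpa using hf.norm_iteratedFDerivWithin_le 0 (by simp) x hx

theorem norm_fderivWithin_le (hf : BoundedC2On A C f) (hA : UniqueDiffOn ℝ A) (hx : x ∈ A) :
    ‖fderivWithin ℝ f A x‖ ≤ C := by
  rw [← norm_iteratedFDerivWithin_one f (hA x hx)]
  exact hf.norm_iteratedFDerivWithin_le 1 (by simp) x hx

theorem differentiableOn (hf : BoundedC2On A C f) : DifferentiableOn ℝ f A :=
  hf.contDiffOn.differentiableOn (by simp)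

theorem norm_sub_le (hf : BoundedC2On A C f) (hA : UniqueDiffOn ℝ A) (hconv : Convex ℝ A)
    (hx : x ∈ A) (hy : y ∈ A) : ‖f y - f x‖ ≤ C * ‖y - x‖ :=
  hconv.norm_image_sub_le_of_norm_fderivWithin_le (𝕜 := ℝ) hf.differentiableOn
    (fun _ hz => hf.norm_fderivWithin_le hA hz) hx hy

theorem norm_fderivWithin_sub_le (hf : BoundedC2On A C f) (hA : UniqueDiffOn ℝ A)
    (hconv : Convex ℝ A) (hx : x ∈ A) (hy : y ∈ A) :
    ‖fderivWithin ℝ f A y - fderivWithin ℝ f A x‖ ≤ C * ‖y - x‖ := by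
  have hdiff : DifferentiableOn ℝ (fderivWithin ℝ f A) A :=
    (hf.contDiffOn.fderivWithin (m := 1) hA (by norm_num)).differentiableOn (by simp)
  refine hconv.norm_image_sub_le_of_norm_fderivWithin_le (𝕜 := ℝ) hdiff (fun z hz => ?_) hx hy
  rw [← norm_iteratedFDerivWithin_one _ (hA z hz), norm_iteratedFDerivWithin_fderivWithin hA hz]
  exact hf.norm_iteratedFDerivWithin_le 2 le_rfl z hz

theorem norm_sub_sub_fderivWithin_le (hf : BoundedC2On A C f) (hA : UniqueDiffOn ℝ A)
    (hconv : Convex ℝ A) (hx : x ∈ A) (hy : y ∈ A) :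
    ‖f y - f x - fderivWithin ℝ f A x (y - x)‖ ≤ C * ‖y - x‖ ^ 2 := by
  have hC : 0 ≤ C := (norm_nonneg _).trans (hf.norm_le hx)
  have hderiv : ∀ z ∈ A ∩ Metric.closedBall x ‖y - x‖,
      ‖fderivWithin ℝ f A z - fderivWithin ℝ f A x‖ ≤ C * ‖y - x‖ := fun z hz =>
    (hf.norm_fderivWithin_sub_le hA hconv hx hz.1).trans
      (mul_le_mul_of_nonneg_left (mem_closedBall_iff_norm.1 hz.2) hC)
  rw [sq, ← mul_assoc]
  exact (hconv.inter (convex_closedBall x ‖y - x‖)).norm_image_sub_le_of_norm_hasFDerivWithin_le'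
    (fun z hz => ((hf.differentiableOn z hz.1).hasFDerivWithinAt).mono Set.inter_subset_left)
    hderiv ⟨hx, Metric.mem_closedBall_self (norm_nonneg _)⟩ ⟨hy, mem_closedBall_iff_norm.2 le_rfl⟩

end BoundedC2On

theorem norm_euclidean_le_mul_sqrt_card {ι : Type*} [Fintype ι] {v : EuclideanSpace ℝ ι} {b : ℝ}
    (hb : 0 ≤ b) (h : ∀ l, |v l| ≤ b) : ‖v‖ ≤ b * √(Fintype.card ι) := by
  rw [EuclideanSpace.norm_eq, ← Real.sqrt_sq hb, ← Real.sqrt_mul (sq_nonneg b)]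
  refine Real.sqrt_le_sqrt ?_
  calc ∑ i, ‖v i‖ ^ 2 ≤ ∑ _i : ι, b ^ 2 :=
        Finset.sum_le_sum fun i _ => pow_le_pow_left₀ (norm_nonneg _) (h i) 2
    _ = b ^ 2 * Fintype.card ι := by simp [mul_comm]

namespace BoundedC2On

variable {ι : Type*} [Fintype ι] {g : E → EuclideanSpace ℝ ι}

/-- The factor `√(Fintype.card ι)` is the norm of the vector with all coordinates equal to one. -/
theorem euclidean (hC : 0 ≤ C) (hA : UniqueDiffOn ℝ A)
    (hg : ∀ l, BoundedC2On A C fun x => g x l) :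
    BoundedC2On A (C * √(Fintype.card ι)) g where
  contDiffOn := contDiffOn_euclidean.2 fun l => (hg l).contDiffOn
  norm_iteratedFDerivWithin_le k hk x hx := by
    have hk2 : (k : WithTop ℕ∞) ≤ 2 := by exact_mod_cast hk
    have hcd : ContDiffOn ℝ 2 g A := contDiffOn_euclidean.2 fun l => (hg l).contDiffOn
    refine ContinuousMultilinearMap.opNorm_le_bound (by positivity) fun v => ?_
    have hcoord : ∀ l, |iteratedFDerivWithin ℝ k g A x v l| ≤ C * ∏ i, ‖v i‖ := by
      intro l
      have hproj := (EuclideanSpace.proj l : EuclideanSpace ℝ ι →L[ℝ] ℝ)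
        |>.iteratedFDerivWithin_comp_left (hcd x hx) hA hx hk2
      calc |iteratedFDerivWithin ℝ k g A x v l|
          = ‖iteratedFDerivWithin ℝ k (fun x => g x l) A x v‖ := by
            exact congrArg (fun L => ‖L v‖) hproj.symm
        _ ≤ C * ∏ i, ‖v i‖ :=
            ContinuousMultilinearMap.le_of_opNorm_le
              ((hg l).norm_iteratedFDerivWithin_le k hk x hx) v
    refine (norm_euclidean_le_mul_sqrt_card (by positivity) hcoord).trans_eq ?_
    ring

theorem const_smul (hf : BoundedC2On A C f) (hA : UniqueDiffOn ℝ A) (a : ℝ) :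
    BoundedC2On A (|a| * C) (a • f) where
  contDiffOn := hf.contDiffOn.const_smul a
  norm_iteratedFDerivWithin_le k hk x hx := by
    have hk2 : (k : WithTop ℕ∞) ≤ 2 := by exact_mod_cast hk
    rw [iteratedFDerivWithin_const_smul_apply ((hf.contDiffOn x hx).of_le hk2) hA hx, norm_smul,
      Real.norm_eq_abs]
    exact mul_le_mul_of_nonneg_left (hf.norm_iteratedFDerivWithin_le k hk x hx) (abs_nonneg a)

end BoundedC2On

end BoundedC2On

/-! ### Singular values and quadratic forms -/

section SingularValues

theorem mul_sq_norm_le_inner_of_le_eigenvalues {V : Type*} [NormedAddCommGroup V]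
    [InnerProductSpace ℝ V] [FiniteDimensional ℝ V] {n : ℕ} {T : V →ₗ[ℝ] V} (hT : T.IsSymmetric)
    (hn : Module.finrank ℝ V = n) {c : ℝ} (hc : ∀ i, c ≤ hT.eigenvalues hn i) (v : V) :
    c * ‖v‖ ^ 2 ≤ inner ℝ (T v) v := by
  set b := hT.eigenvectorBasis hn
  have hTv : ∀ i, inner ℝ (T v) (b i) * inner ℝ (b i) v =
      hT.eigenvalues hn i * inner ℝ (b i) v ^ 2 := fun i => by
    rw [hT v (b i), hT.apply_eigenvectorBasis hn i, inner_smul_right, real_inner_comm v]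
    simp only [RCLike.ofReal_real_eq_id, id_eq]
    ring
  calc c * ‖v‖ ^ 2 = ∑ i, c * inner ℝ (b i) v ^ 2 := by
        rw [← b.sum_sq_norm_inner_right v, Finset.mul_sum]
        simp only [Real.norm_eq_abs, sq_abs]
    _ ≤ ∑ i, hT.eigenvalues hn i * inner ℝ (b i) v ^ 2 :=
        Finset.sum_le_sum fun i _ => mul_le_mul_of_nonneg_right (hc i) (sq_nonneg _)
    _ = inner ℝ (T v) v := by rw [← b.sum_inner_mul_inner]; simp only [hTv]

variable {r : ℕ} {G : Matrix (Fin r) (Fin r) ℝ}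

theorem sMin_nonneg (G : Matrix (Fin r) (Fin r) ℝ) : 0 ≤ sMin G :=
  (Matrix.toEuclideanLin G).singularValues_nonneg _

theorem sMin_mul_norm_le (G : Matrix (Fin r) (Fin r) ℝ) (v : EuclideanSpace ℝ (Fin r)) :
    sMin G * ‖v‖ ≤ ‖Matrix.toEuclideanLin G v‖ := by
  set T := Matrix.toEuclideanLin G
  have hn : Module.finrank ℝ (EuclideanSpace ℝ (Fin r)) = r := by simp
  have hS := T.isSymmetric_adjoint_comp_self
  have heig : ∀ i, sMin G ^ 2 ≤ hS.eigenvalues hn i := fun i => by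
    rw [← T.sq_singularValues_fin hn i]
    exact pow_le_pow_left₀ (sMin_nonneg G) (T.singularValues_antitone (by omega)) 2
  refine le_of_sq_le_sq ?_ (norm_nonneg _)
  calc (sMin G * ‖v‖) ^ 2 = sMin G ^ 2 * ‖v‖ ^ 2 := mul_pow ..
    _ ≤ inner ℝ ((T.adjoint ∘ₗ T) v) v := mul_sq_norm_le_inner_of_le_eigenvalues hS hn heig v
    _ = ‖T v‖ ^ 2 := by
        rw [LinearMap.comp_apply, LinearMap.adjoint_inner_left, real_inner_self_eq_norm_sq]

theorem sMin_mul_sq_norm_le_inner (hG : G.PosSemidef) (v : EuclideanSpace ℝ (Fin r)) :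
    sMin G * ‖v‖ ^ 2 ≤ inner ℝ (Matrix.toEuclideanLin G v) v := by
  have hpos := Matrix.isPositive_toEuclideanLin_iff.2 hG
  have hn : Module.finrank ℝ (EuclideanSpace ℝ (Fin r)) = r := by simp
  refine mul_sq_norm_le_inner_of_le_eigenvalues hpos.isSymmetric hn (fun i => ?_) v
  have h := sMin_mul_norm_le G (hpos.isSymmetric.eigenvectorBasis hn i)
  rw [hpos.isSymmetric.apply_eigenvectorBasis hn i, norm_smul, OrthonormalBasis.norm_eq_one,
    mul_one, mul_one] at h
  simpa [abs_of_nonneg (hpos.nonneg_eigenvalues hn i)] using h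

theorem inner_toEuclideanLin_transpose_mul_self {ι : Type*} [Fintype ι]
    (J : Matrix ι (Fin r) ℝ) (v : EuclideanSpace ℝ (Fin r)) :
    inner ℝ (Matrix.toEuclideanLin (J.transpose * J) v) v = ‖Matrix.toEuclideanLin J v‖ ^ 2 := by
  rw [← real_inner_self_eq_norm_sq]
  simp only [Matrix.toLpLin_apply, EuclideanSpace.inner_eq_star_dotProduct, star_trivial,
    ← Matrix.mulVec_mulVec]
  rw [Matrix.mulVec_transpose, dotProduct_comm, ← Matrix.dotProduct_mulVec]

end SingularValues

/-! ### Tangent directions seen from the surface -/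

section Surface

variable {E V : Type*} [NormedAddCommGroup E] [NormedSpace ℝ E] [NormedAddCommGroup V]
  [InnerProductSpace ℝ V] {A : Set E} {x₀ x y d z z' : E} {B C b c κ ρ t : ℝ} {g : E → V}

theorem exists_mem_le_abs_inner_sub {D : E →L[ℝ] V} (hρ : 0 ≤ ρ)
    (hball : Metric.closedBall x₀ ρ ⊆ A) (hD : ∀ v, c * ‖v‖ ^ 2 ≤ ‖D v‖ ^ 2) (x d : E) :
    ∃ z ∈ A, ρ * c * ‖d‖ ≤ |inner ℝ (D d) (D (z - x))| := by
  rcases eq_or_ne d 0 with rfl | hd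
  · exact ⟨x₀, hball (Metric.mem_closedBall_self hρ), by simp⟩
  have hd0 : 0 < ‖d‖ := norm_pos_iff.2 hd
  set e := (ρ / ‖d‖) • d with he
  have hnorm : ‖e‖ = ρ := by
    rw [he, norm_smul, Real.norm_of_nonneg (by positivity), div_mul_cancel₀ _ hd0.ne']
  have hinner : ρ * c * ‖d‖ ≤ inner ℝ (D d) (D e) := by
    calc ρ * c * ‖d‖ = ρ / ‖d‖ * (c * ‖d‖ ^ 2) := by field_simp
      _ ≤ ρ / ‖d‖ * ‖D d‖ ^ 2 := mul_le_mul_of_nonneg_left (hD d) (by positivity)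
      _ = inner ℝ (D d) (D e) := by
        rw [he, map_smul, inner_smul_right, real_inner_self_eq_norm_sq]
  rcases le_total 0 (inner ℝ (D d) (D (x₀ - x))) with h | h
  · refine ⟨x₀ + e, hball (by simp [hnorm]), le_trans ?_ (le_abs_self _)⟩
    rw [add_sub_right_comm, map_add, inner_add_right]
    linarith
  · refine ⟨x₀ - e, hball (by simp [hnorm]), le_trans ?_ (neg_le_abs _)⟩
    rw [sub_right_comm, map_sub, inner_sub_right]
    linarith

namespace BoundedC2On

variable (hg : BoundedC2On A C g) (hA : UniqueDiffOn ℝ A) (hconv : Convex ℝ A)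
include hg hA hconv

/-- A step of relative length `t` along a chord has a component of order `t` in the tangent
direction and a curvature error of order `t ^ 2`; so one of its endpoints sees the direction. -/
theorem exists_mem_le_abs_inner_fderivWithin (hB : ∀ z ∈ A, ‖z - x‖ ≤ B) (hρ : 0 ≤ ρ)
    (hball : Metric.closedBall x₀ ρ ⊆ A) (ht : 0 ≤ t) (ht1 : t ≤ 1)
    (htB : C ^ 2 * B ^ 2 * t ≤ ρ * c / 2) (hx : x ∈ A)
    (hD : ∀ v, c * ‖v‖ ^ 2 ≤ ‖fderivWithin ℝ g A x v‖ ^ 2) (d : E) :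
    ∃ z ∈ A, t * ρ * c / 4 * ‖d‖ ≤ |inner ℝ (fderivWithin ℝ g A x d) (g z)| := by
  set D := fderivWithin ℝ g A x
  have hC : 0 ≤ C := (norm_nonneg _).trans (hg.norm_le hx)
  have hDd : ‖D d‖ ≤ C * ‖d‖ := D.le_of_opNorm_le (hg.norm_fderivWithin_le hA hx) d
  obtain ⟨w, hwA, hw⟩ := exists_mem_le_abs_inner_sub hρ hball hD x d
  set z := x + t • (w - x)
  have hzA : z ∈ A := hconv.add_smul_sub_mem hx hwA ⟨ht, ht1⟩
  have hzx : z - x = t • (w - x) := add_sub_cancel_left _ _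
  have hzx_norm : ‖z - x‖ ≤ t * B := by
    rw [hzx, norm_smul, Real.norm_of_nonneg ht]
    exact mul_le_mul_of_nonneg_left (hB w hwA) ht
  have hremainder : |inner ℝ (D d) (g z - g x - D (z - x))| ≤ t * (ρ * c / 2) * ‖d‖ := by
    calc |inner ℝ (D d) (g z - g x - D (z - x))|
        ≤ ‖D d‖ * ‖g z - g x - D (z - x)‖ := abs_real_inner_le_norm _ _
      _ ≤ C * ‖d‖ * (C * (t * B) ^ 2) := by
          refine mul_le_mul hDd ?_ (norm_nonneg _) (by positivity)
          refine (hg.norm_sub_sub_fderivWithin_le hA hconv hx hzA).trans ?_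
          gcongr
      _ = t * (C ^ 2 * B ^ 2 * t) * ‖d‖ := by ring
      _ ≤ t * (ρ * c / 2) * ‖d‖ := by gcongr
  have hchord : t * (ρ * c * ‖d‖) ≤ |inner ℝ (D d) (D (z - x))| := by
    rw [hzx, map_smul, inner_smul_right, abs_mul, abs_of_nonneg ht]
    exact mul_le_mul_of_nonneg_left hw ht
  have hsplit : inner ℝ (D d) (D (z - x)) =
      inner ℝ (D d) (g z) - inner ℝ (D d) (g x) - inner ℝ (D d) (g z - g x - D (z - x)) := by
    rw [← inner_sub_right, ← inner_sub_right, sub_sub_cancel]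
  have htri : |inner ℝ (D d) (D (z - x))| ≤ |inner ℝ (D d) (g z)| + |inner ℝ (D d) (g x)| +
      |inner ℝ (D d) (g z - g x - D (z - x))| := by
    rw [hsplit]
    exact (abs_sub _ _).trans (add_le_add_left (abs_sub _ _) _)
  by_contra! hsmall
  linarith [hsmall z hzA, hsmall x hx]

theorem le_abs_inner_sub (hx : x ∈ A) (hy : y ∈ A) (hz : z ∈ A) (hz' : z' ∈ A)
    (hyx : ‖y - x‖ ≤ κ) (hzz' : ‖z' - z‖ ≤ κ)
    (hb : b * ‖y - x‖ ≤ |inner ℝ (fderivWithin ℝ g A x (y - x)) (g z)|) :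
    (b - 2 * C ^ 2 * κ) * ‖y - x‖ ≤ |inner ℝ (g y - g x) (g z')| := by
  set Dd := fderivWithin ℝ g A x (y - x)
  have hC : 0 ≤ C := (norm_nonneg _).trans (hg.norm_le hx)
  have hDd : ‖Dd‖ ≤ C * ‖y - x‖ :=
    (fderivWithin ℝ g A x).le_of_opNorm_le (hg.norm_fderivWithin_le hA hx) _
  have hmove : |inner ℝ Dd (g z' - g z)| ≤ C * ‖y - x‖ * (C * κ) := by
    refine (abs_real_inner_le_norm _ _).trans (mul_le_mul hDd ?_ (norm_nonneg _) (by positivity))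
    exact (hg.norm_sub_le hA hconv hz hz').trans (by gcongr)
  have hremainder : |inner ℝ (g y - g x - Dd) (g z')| ≤ C * (‖y - x‖ * κ) * C := by
    refine (abs_real_inner_le_norm _ _).trans
      (mul_le_mul ?_ (hg.norm_le hz') (norm_nonneg _) ?_)
    · refine (hg.norm_sub_sub_fderivWithin_le hA hconv hx hy).trans ?_
      rw [sq]
      gcongr
    · exact mul_nonneg hC (mul_nonneg (norm_nonneg _) ((norm_nonneg _).trans hyx))
  have hsplit : inner ℝ Dd (g z) = inner ℝ (g y - g x) (g z') -
      inner ℝ (g y - g x - Dd) (g z') - inner ℝ Dd (g z' - g z) := by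
    rw [inner_sub_left (g y - g x), inner_sub_right]
    ring
  have htri : |inner ℝ Dd (g z)| ≤ |inner ℝ (g y - g x) (g z')| +
      |inner ℝ (g y - g x - Dd) (g z')| + |inner ℝ Dd (g z' - g z)| := by
    rw [hsplit]
    exact (abs_sub _ _).trans (add_le_add_left (abs_sub _ _) _)
  linarith

end BoundedC2On

theorem exists_forall_le_abs_inner_sub (hbdd : Bornology.IsBounded A) (hconv : Convex ℝ A)
    (hint : (interior A).Nonempty) (C : ℝ) (hc : 0 < c) :
    ∃ κ > 0, ∃ b > 0, ∀ (V : Type*) [NormedAddCommGroup V] [InnerProductSpace ℝ V] (g : E → V),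
      BoundedC2On A C g → ∀ x ∈ A, (∀ v, c * ‖v‖ ^ 2 ≤ ‖fderivWithin ℝ g A x v‖ ^ 2) →
      ∀ y ∈ A, ‖y - x‖ ≤ κ → ∃ z ∈ A, ∀ z' ∈ A, ‖z' - z‖ ≤ κ →
        b * ‖y - x‖ ≤ |inner ℝ (g y - g x) (g z')| := by
  have hA : UniqueDiffOn ℝ A := uniqueDiffOn_convex hconv hint
  obtain ⟨x₀, hx₀⟩ := hint
  obtain ⟨ρ, hρ, hball⟩ := Metric.nhds_basis_closedBall.mem_iff.1 (mem_interior_iff_mem_nhds.1 hx₀)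
  obtain ⟨B, hB⟩ := Metric.isBounded_iff.1 hbdd
  obtain ⟨t, ht, ht1, htB⟩ : ∃ t > 0, t ≤ 1 ∧ C ^ 2 * B ^ 2 * t ≤ ρ * c / 2 := by
    refine ⟨min 1 (ρ * c / 2 / (C ^ 2 * B ^ 2 + 1)), lt_min one_pos (by positivity),
      min_le_left _ _, ?_⟩
    calc _ ≤ (C ^ 2 * B ^ 2 + 1) * (ρ * c / 2 / (C ^ 2 * B ^ 2 + 1)) :=
          mul_le_mul (by linarith) (min_le_right _ _) (by positivity) (by positivity)
      _ = ρ * c / 2 := mul_div_cancel₀ _ (by positivity)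
  obtain ⟨κ, hκ, hκC⟩ : ∃ κ > 0, 2 * C ^ 2 * κ ≤ t * ρ * c / 8 := by
    refine ⟨t * ρ * c / 8 / (2 * C ^ 2 + 1), by positivity, ?_⟩
    calc _ ≤ (2 * C ^ 2 + 1) * (t * ρ * c / 8 / (2 * C ^ 2 + 1)) := by gcongr; linarith
      _ = t * ρ * c / 8 := mul_div_cancel₀ _ (by positivity)
  refine ⟨κ, hκ, t * ρ * c / 8, by positivity, fun V _ _ g hg x hx hD y hy hyx => ?_⟩
  obtain ⟨z, hz, hzb⟩ := hg.exists_mem_le_abs_inner_fderivWithin hA hconv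
    (fun z hz => dist_eq_norm z x ▸ hB hz hx) hρ.le hball ht.le ht1 htB hx hD (y - x)
  refine ⟨z, hz, fun z' hz' hzz' => le_trans ?_
    (hg.le_abs_inner_sub hA hconv hx hy hz hz' hyx hzz' hzb)⟩
  exact mul_le_mul_of_nonneg_right (by linarith) (norm_nonneg _)

end Surface

/-! ### A Fuk–Nagaev inequality -/

section ExpBounds

variable {q s t x y T : ℝ}

theorem exp_le_div_rpow_mul_exp (hq : 0 ≤ q) (hs : 0 < s) (hqs : q ≤ s) (hsT : s ≤ T) :
    Real.exp s ≤ (s / T) ^ q * Real.exp T := by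
  have hT : 0 < T := hs.trans_le hsT
  have hlog : Real.log (T / s) * q ≤ T - s := by
    calc Real.log (T / s) * q ≤ (T / s - 1) * s :=
          mul_le_mul (Real.log_le_sub_one_of_pos (by positivity)) hqs hq
            (sub_nonneg.2 ((one_le_div hs).2 hsT))
      _ = T - s := by field_simp
  rw [Real.rpow_def_of_pos (by positivity), ← Real.exp_add, ← inv_div, Real.log_inv]
  exact Real.exp_le_exp.2 (by linarith)

theorem exp_le_one_add_add_sq (hs : s ≤ 1) : Real.exp s ≤ 1 + s + s ^ 2 := by
  rcases le_or_gt (-1) s with h | h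
  · linarith [le_abs_self (Real.exp s - 1 - s), Real.abs_exp_sub_one_sub_id_le (abs_le.2 ⟨h, hs⟩)]
  · nlinarith [Real.exp_le_one_iff.2 (show s ≤ 0 by linarith)]

theorem exp_le_one_add_add_sq_add_rpow (hq : 0 ≤ q) (hT : 0 < T) (hs : s ≤ T) :
    Real.exp s ≤ 1 + s + Real.exp q * s ^ 2 + (|s| / T) ^ q * Real.exp T := by
  have hq1 : 1 ≤ Real.exp q := Real.one_le_exp hq
  have hrpow : 0 ≤ (|s| / T) ^ q * Real.exp T := by positivity
  rcases le_or_gt s 1 with hs1 | hs1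
  · nlinarith [exp_le_one_add_add_sq hs1, sq_nonneg s]
  have hquad : 0 ≤ Real.exp q * (s ^ 2 - 1) := mul_nonneg (Real.exp_pos q).le (by nlinarith)
  rcases le_or_gt s q with hsq | hsq
  · linarith [Real.exp_le_exp.2 hsq]
  · have h := exp_le_div_rpow_mul_exp hq (by linarith) hsq.le hs
    rw [abs_of_pos (by linarith)] at hrpow ⊢
    linarith

theorem div_rpow_mul_exp_eq (ht : 0 < t) (hy : 0 < y) (x : ℝ) :
    (|t * x| / (t * y)) ^ q * Real.exp (t * y) =
      y ^ (-q) * Real.exp (t * y) * |x| ^ q := by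
  rw [abs_mul, abs_of_pos ht, mul_div_mul_left _ _ ht.ne', Real.div_rpow (abs_nonneg _) hy.le,
    Real.rpow_neg hy.le]
  field_simp

theorem exp_mul_min_le (hq : 0 ≤ q) (ht : 0 < t) (hy : 0 < y) (x : ℝ) :
    Real.exp (t * min x y) ≤
      1 + t * x + Real.exp q * t ^ 2 * x ^ 2 + y ^ (-q) * Real.exp (t * y) * |x| ^ q := by
  rw [← div_rpow_mul_exp_eq ht hy]
  rcases le_total x y with h | h
  · rw [min_eq_left h, mul_assoc (Real.exp q), ← mul_pow]
    exact exp_le_one_add_add_sq_add_rpow hq (mul_pos ht hy) (mul_le_mul_of_nonneg_left h ht.le)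
  · rw [min_eq_right h]
    have hx : 0 < x := hy.trans_le h
    have hratio : 1 ≤ (|t * x| / (t * y)) ^ q := by
      refine Real.one_le_rpow ?_ hq
      rw [abs_of_pos (by positivity), one_le_div (by positivity)]
      gcongr
    have hpoly : 0 ≤ 1 + t * x + Real.exp q * t ^ 2 * x ^ 2 := by positivity
    nlinarith [Real.exp_pos (t * y)]

theorem sq_le_one_add_abs_rpow (hq : 2 ≤ q) (x : ℝ) : x ^ 2 ≤ 1 + |x| ^ q := by
  rcases le_or_gt |x| 1 with h | h
  · linarith [(sq_le_one_iff_abs_le_one x).2 h, Real.rpow_nonneg (abs_nonneg x) q]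
  · have : |x| ^ (2 : ℝ) ≤ |x| ^ q := Real.rpow_le_rpow_of_exponent_le h.le hq
    rw [Real.rpow_two, sq_abs] at this
    linarith

end ExpBounds

section IndepCentered

variable {Ω ι κ : Type*} [MeasurableSpace Ω] {P : Measure Ω} {v : ι → Ω → ℝ} {q K t y : ℝ}

/-- Under `P`, the random variables `v i` are independent and centred, and their absolute moments
of order `q` are at most `K`. -/
structure IndepCentered (v : ι → Ω → ℝ) (P : Measure Ω) (q K : ℝ) : Prop where
  indep : iIndepFun v P
  measurable : ∀ i, Measurable (v i)
  integral_eq_zero : ∀ i, ∫ ω, v i ω ∂P = 0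
  integrable_rpow : ∀ i, Integrable (fun ω => |v i ω| ^ q) P
  integral_rpow_le : ∀ i, ∫ ω, |v i ω| ^ q ∂P ≤ K

/-- The bound of the Fuk–Nagaev inequality for the probability that a sum of `N` independent
centred variables, with absolute moments of order `q` at most `K`, exceeds `x`. The summands are
truncated at the level `y`, and `t` is the argument of the moment generating function. -/
noncomputable def fukNagaevBound (q K N t y x : ℝ) : ℝ :=
  N * (K * y ^ (-q)) +
    Real.exp (-t * x + N * (Real.exp q * t ^ 2 * (1 + K) + y ^ (-q) * Real.exp (t * y) * K))

theorem fukNagaevBound_mono_card {N N' x : ℝ} (hK : 0 ≤ K) (hNN' : N ≤ N') (hy : 0 ≤ y) :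
    fukNagaevBound q K N t y x ≤ fukNagaevBound q K N' t y x := by
  unfold fukNagaevBound
  gcongr

namespace IndepCentered

theorem isProbabilityMeasure (h : IndepCentered v P q K) : IsProbabilityMeasure P :=
  h.indep.isProbabilityMeasure

theorem integrable_sq (h : IndepCentered v P q K) (hq : 2 ≤ q) (i : ι) :
    Integrable (fun ω => v i ω ^ 2) P := by
  have := h.isProbabilityMeasure
  refine ((integrable_const 1).add (h.integrable_rpow i)).mono'
    ((h.measurable i).pow_const 2).aestronglyMeasurable (Eventually.of_forall fun ω => ?_)
  rw [Real.norm_of_nonneg (sq_nonneg _)]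
  exact sq_le_one_add_abs_rpow hq _

theorem integrable (h : IndepCentered v P q K) (hq : 2 ≤ q) (i : ι) : Integrable (v i) P := by
  have := h.isProbabilityMeasure
  exact ((memLp_two_iff_integrable_sq (h.measurable i).aestronglyMeasurable).2
    (h.integrable_sq hq i)).integrable one_le_two

theorem integral_sq_le (h : IndepCentered v P q K) (hq : 2 ≤ q) (i : ι) :
    ∫ ω, v i ω ^ 2 ∂P ≤ 1 + K := by
  have := h.isProbabilityMeasure
  calc ∫ ω, v i ω ^ 2 ∂P ≤ ∫ ω, (1 + |v i ω| ^ q) ∂P :=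
        integral_mono (h.integrable_sq hq i) ((integrable_const 1).add (h.integrable_rpow i))
          fun ω => sq_le_one_add_abs_rpow hq _
    _ = 1 + ∫ ω, |v i ω| ^ q ∂P := by
        simp [integral_add (integrable_const (1 : ℝ)) (h.integrable_rpow i)]
    _ ≤ 1 + K := by linarith [h.integral_rpow_le i]

theorem moment_nonneg (h : IndepCentered v P q K) (i : ι) : 0 ≤ K :=
  (integral_nonneg fun _ => by positivity).trans (h.integral_rpow_le i)

theorem integrable_exp_mul_min (h : IndepCentered v P q K) (ht : 0 ≤ t) (y : ℝ) (i : ι) :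
    Integrable (fun ω => Real.exp (t * min (v i ω) y)) P := by
  have := h.isProbabilityMeasure
  have hmeas := h.measurable i
  refine Integrable.of_bound (by fun_prop) (Real.exp (t * y)) (Eventually.of_forall fun ω => ?_)
  rw [Real.norm_of_nonneg (Real.exp_pos _).le]
  exact Real.exp_le_exp.2 (mul_le_mul_of_nonneg_left (min_le_right _ _) ht)

theorem mgf_min_le (h : IndepCentered v P q K) (hq : 2 ≤ q) (ht : 0 < t) (hy : 0 < y) (i : ι) :
    mgf (fun ω => min (v i ω) y) P t ≤
      Real.exp (Real.exp q * t ^ 2 * (1 + K) + y ^ (-q) * Real.exp (t * y) * K) := by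
  have := h.isProbabilityMeasure
  have hlin : Integrable (fun ω => 1 + t * v i ω) P :=
    (integrable_const 1).add ((h.integrable hq i).const_mul t)
  have hsq := (h.integrable_sq hq i).const_mul (Real.exp q * t ^ 2)
  have hquad : Integrable (fun ω => 1 + t * v i ω + Real.exp q * t ^ 2 * v i ω ^ 2) P :=
    hlin.add hsq
  have hrpow := (h.integrable_rpow i).const_mul (y ^ (-q) * Real.exp (t * y))
  calc mgf (fun ω => min (v i ω) y) P t
      ≤ ∫ ω, (1 + t * v i ω + Real.exp q * t ^ 2 * v i ω ^ 2 +
          y ^ (-q) * Real.exp (t * y) * |v i ω| ^ q) ∂P :=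
        integral_mono (h.integrable_exp_mul_min ht.le y i) (hquad.add hrpow)
          fun ω => exp_mul_min_le (by linarith) ht hy _
    _ = 1 + Real.exp q * t ^ 2 * ∫ ω, v i ω ^ 2 ∂P +
          y ^ (-q) * Real.exp (t * y) * ∫ ω, |v i ω| ^ q ∂P := by
        rw [integral_add hquad hrpow, integral_add hlin hsq,
          integral_add (integrable_const 1) ((h.integrable hq i).const_mul t),
          integral_const_mul, integral_const_mul, integral_const_mul, h.integral_eq_zero i]
        simp
    _ ≤ 1 + Real.exp q * t ^ 2 * (1 + K) + y ^ (-q) * Real.exp (t * y) * K := by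
        gcongr
        exacts [h.integral_sq_le hq i, h.integral_rpow_le i]
    _ ≤ _ := by
        rw [add_assoc, add_comm]
        exact Real.add_one_le_exp _

variable [Fintype ι]

theorem measureReal_le_sum_min_le (h : IndepCentered v P q K) (hq : 2 ≤ q) (ht : 0 < t)
    (hy : 0 < y) (x : ℝ) :
    P.real {ω | x ≤ ∑ i, min (v i ω) y} ≤ Real.exp (-t * x + Fintype.card ι *
      (Real.exp q * t ^ 2 * (1 + K) + y ^ (-q) * Real.exp (t * y) * K)) := by
  have := h.isProbabilityMeasure
  set w : ι → Ω → ℝ := fun i ω => min (v i ω) y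
  have hmeas : ∀ i, Measurable (w i) := fun i => (h.measurable i).min measurable_const
  have hindep : iIndepFun w P := h.indep.comp (fun _ z => min z y) fun _ => by fun_prop
  have hmgf : mgf (∑ i, w i) P t ≤ Real.exp (Fintype.card ι *
      (Real.exp q * t ^ 2 * (1 + K) + y ^ (-q) * Real.exp (t * y) * K)) := by
    rw [hindep.mgf_sum hmeas, Real.exp_nat_mul, ← Finset.card_univ, ← Finset.prod_const]
    exact Finset.prod_le_prod (fun i _ => mgf_nonneg) fun i _ => h.mgf_min_le hq ht hy i
  have hchernoff := measure_ge_le_exp_mul_mgf (μ := P) (X := ∑ i, w i) x ht.le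
    (hindep.integrable_exp_mul_sum hmeas fun i _ => h.integrable_exp_mul_min ht.le y i)
  simp only [Finset.sum_apply] at hchernoff
  rw [Real.exp_add]
  exact hchernoff.trans (mul_le_mul_of_nonneg_left hmgf (Real.exp_pos _).le)

theorem measureReal_exists_lt_le (h : IndepCentered v P q K) (hq : 0 < q) (hy : 0 < y) :
    P.real {ω | ∃ i, y < v i ω} ≤ Fintype.card ι * (K * y ^ (-q)) := by
  have := h.isProbabilityMeasure
  have hmarkov : ∀ i, P.real {ω | y ^ q ≤ |v i ω| ^ q} ≤ K * y ^ (-q) := fun i => by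
    rw [Real.rpow_neg hy.le, ← div_eq_mul_inv, le_div_iff₀ (by positivity), mul_comm]
    exact (mul_meas_ge_le_integral_of_nonneg (Eventually.of_forall fun ω => by positivity)
      (h.integrable_rpow i) (y ^ q)).trans (h.integral_rpow_le i)
  calc P.real {ω | ∃ i, y < v i ω} ≤ P.real (⋃ i, {ω | y ^ q ≤ |v i ω| ^ q}) := by
        refine measureReal_mono fun ω ⟨i, hi⟩ => Set.mem_iUnion.2 ⟨i, ?_⟩
        exact Real.rpow_le_rpow hy.le (hi.le.trans (le_abs_self _)) hq.le
    _ ≤ ∑ i, P.real {ω | y ^ q ≤ |v i ω| ^ q} := measureReal_iUnion_fintype_le _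
    _ ≤ ∑ _i : ι, K * y ^ (-q) := Finset.sum_le_sum fun i _ => hmarkov i
    _ = Fintype.card ι * (K * y ^ (-q)) := by simp

theorem measureReal_le_sum_le (h : IndepCentered v P q K) (hq : 2 ≤ q) (ht : 0 < t) (hy : 0 < y)
    (x : ℝ) :
    P.real {ω | x ≤ ∑ i, v i ω} ≤ fukNagaevBound q K (Fintype.card ι) t y x := by
  have := h.isProbabilityMeasure
  have htruncate : {ω | x ≤ ∑ i, v i ω} ⊆
      {ω | ∃ i, y < v i ω} ∪ {ω | x ≤ ∑ i, min (v i ω) y} := by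
    intro ω hω
    by_cases hlarge : ∃ i, y < v i ω
    · exact .inl hlarge
    · push Not at hlarge
      exact .inr (hω.trans_eq (Finset.sum_congr rfl fun i _ => (min_eq_left (hlarge i)).symm))
  calc P.real {ω | x ≤ ∑ i, v i ω} ≤ _ := measureReal_mono htruncate
    _ ≤ _ := measureReal_union_le _ _
    _ ≤ _ := add_le_add (h.measureReal_exists_lt_le (by linarith) hy)
        (h.measureReal_le_sum_min_le hq ht hy x)

omit [Fintype ι] in
theorem neg (h : IndepCentered v P q K) : IndepCentered (fun i ω => -v i ω) P q K where
  indep := h.indep.comp (fun _ z => -z) fun _ => measurable_neg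
  measurable i := (h.measurable i).neg
  integral_eq_zero i := by rw [integral_neg, h.integral_eq_zero i, neg_zero]
  integrable_rpow := by simpa only [abs_neg] using h.integrable_rpow
  integral_rpow_le := by simpa only [abs_neg] using h.integral_rpow_le

theorem measureReal_le_abs_sum_le (h : IndepCentered v P q K) (hq : 2 ≤ q) (ht : 0 < t)
    (hy : 0 < y) (x : ℝ) :
    P.real {ω | x ≤ |∑ i, v i ω|} ≤ 2 * fukNagaevBound q K (Fintype.card ι) t y x := by
  have := h.isProbabilityMeasure
  have hsub : {ω | x ≤ |∑ i, v i ω|} ⊆ {ω | x ≤ ∑ i, v i ω} ∪ {ω | x ≤ ∑ i, -v i ω} :=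
    fun ω hω => by simpa [le_abs] using hω
  linarith [(measureReal_mono (μ := P) hsub).trans (measureReal_union_le _ _),
    h.measureReal_le_sum_le hq ht hy x, h.neg.measureReal_le_sum_le hq ht hy x]

end IndepCentered

theorem iIndepFun_prodMk_of_injective_sumElim {β : Type*} [MeasurableSpace β] [Finite κ]
    {Z : ι → Ω → β} (hZ : iIndepFun Z P) (hmeas : ∀ i, Measurable (Z i)) {a b : κ → ι}
    (hab : Function.Injective (Sum.elim a b)) :
    iIndepFun (fun k ω => (Z (a k) ω, Z (b k) ω)) P := by
  have := Fintype.ofFinite κ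
  have := hZ.isProbabilityMeasure
  have : ∀ i, IsProbabilityMeasure (P.map (Z i)) := fun i =>
    Measure.isProbabilityMeasure_map (hmeas i).aemeasurable
  have hpair : ∀ k, P.map (fun ω => (Z (a k) ω, Z (b k) ω)) =
      (P.map (Z (a k))).prod (P.map (Z (b k))) := fun k =>
    (indepFun_iff_map_prod_eq_prod_map_map (hmeas _).aemeasurable (hmeas _).aemeasurable).1
      (hZ.indepFun fun h => Sum.inl_ne_inr (hab (a₁ := .inl k) (a₂ := .inr k) h))
  have hlaw : MeasurePreserving (fun ω i => Z (Sum.elim a b i) ω) P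
      (Measure.pi fun i => P.map (Z (Sum.elim a b i))) :=
    ⟨by fun_prop, (hZ.precomp hab).map_fun_eq_pi_map fun i => (hmeas _).aemeasurable⟩
  have hpairs := ((measurePreserving_arrowProdEquivProdArrow β β κ (fun k => P.map (Z (a k)))
    fun k => P.map (Z (b k))).symm.comp (measurePreserving_sumPiEquivProdPi
      fun i => P.map (Z (Sum.elim a b i)))).comp hlaw
  rw [iIndepFun_iff_map_fun_eq_pi_map fun k => by fun_prop]
  simp only [hpair]
  exact hpairs.map_eq

namespace IndepCentered

theorem mono {K' : ℝ} (h : IndepCentered v P q K) (hKK' : K ≤ K') : IndepCentered v P q K' :=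
  { h with integral_rpow_le := fun i => (h.integral_rpow_le i).trans hKK' }

theorem precomp {a : κ → ι} (h : IndepCentered v P q K) (ha : Function.Injective a) :
    IndepCentered (fun k => v (a k)) P q K where
  indep := h.indep.precomp ha
  measurable k := h.measurable (a k)
  integral_eq_zero k := h.integral_eq_zero (a k)
  integrable_rpow k := h.integrable_rpow (a k)
  integral_rpow_le k := h.integral_rpow_le (a k)

theorem mul_const {c : ι → ℝ} {C : ℝ} (h : IndepCentered v P q K) (hq : 0 ≤ q)
    (hc : ∀ i, |c i| ≤ C) : IndepCentered (fun i ω => v i ω * c i) P q (K * C ^ q) where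
  indep := h.indep.comp (fun i z => z * c i) fun _ => by fun_prop
  measurable i := (h.measurable i).mul_const _
  integral_eq_zero i := by rw [integral_mul_const, h.integral_eq_zero, zero_mul]
  integrable_rpow i := by
    simpa only [abs_mul, Real.mul_rpow (abs_nonneg _) (abs_nonneg _)] using
      (h.integrable_rpow i).mul_const _
  integral_rpow_le i := by
    simp only [abs_mul, Real.mul_rpow (abs_nonneg _) (abs_nonneg _), integral_mul_const]
    exact mul_le_mul (h.integral_rpow_le i) (Real.rpow_le_rpow (abs_nonneg _) (hc i) hq)
      (by positivity) (h.moment_nonneg i)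

theorem mul [Finite κ] {a b : κ → ι} (h : IndepCentered v P q K)
    (hab : Function.Injective (Sum.elim a b)) :
    IndepCentered (fun k ω => v (a k) ω * v (b k) ω) P q (K * K) := by
  have hindep : ∀ k, IndepFun (v (a k)) (v (b k)) P := fun k =>
    h.indep.indepFun fun hk => Sum.inl_ne_inr (hab (a₁ := .inl k) (a₂ := .inr k) hk)
  have hindep_rpow : ∀ k, IndepFun (fun ω => |v (a k) ω| ^ q) (fun ω => |v (b k) ω| ^ q) P :=
    fun k => (hindep k).comp (φ := fun z => |z| ^ q) (ψ := fun z => |z| ^ q)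
      (by fun_prop) (by fun_prop)
  have hmul : ∀ k ω, |v (a k) ω * v (b k) ω| ^ q = |v (a k) ω| ^ q * |v (b k) ω| ^ q :=
    fun k ω => by rw [abs_mul, Real.mul_rpow (abs_nonneg _) (abs_nonneg _)]
  refine ⟨(iIndepFun_prodMk_of_injective_sumElim h.indep h.measurable hab).comp
    (fun _ z => z.1 * z.2) fun _ => by fun_prop, fun k => (h.measurable _).mul (h.measurable _),
    fun k => ?_, fun k => ?_, fun k => ?_⟩
  · rw [(hindep k).integral_fun_mul_eq_mul_integral (h.measurable _).aestronglyMeasurable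
      (h.measurable _).aestronglyMeasurable, h.integral_eq_zero, zero_mul]
  · simp only [hmul]
    exact (hindep_rpow k).integrable_mul (h.integrable_rpow _) (h.integrable_rpow _)
  · simp only [hmul]
    rw [(hindep_rpow k).integral_fun_mul_eq_mul_integral (h.integrable_rpow _).aestronglyMeasurable
      (h.integrable_rpow _).aestronglyMeasurable]
    exact mul_le_mul (h.integral_rpow_le _) (h.integral_rpow_le _)
      (integral_nonneg fun ω => by positivity) (h.moment_nonneg (a k))

end IndepCentered

end IndepCentered

/-! ### The rate -/

section Rate

variable {ν L P D N q K b : ℝ}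

theorem mul_sqrt_div_eq_sqrt_mul (hP : 0 < P) (L : ℝ) : P * √(L / P) = √(P * L) := by
  rw [show P * L = P ^ 2 * (L / P) by field_simp, Real.sqrt_mul (sq_nonneg P), Real.sqrt_sq hP.le]

theorem div_le_mul_rpow_div_rpow (hν : 0 < ν) (hN : 0 < N) (hL : 0 < L) (hP : 0 < P)
    (h : N ^ (4 / ν) * L ^ ((ν - 2) / ν) ≤ D * P) :
    L / P ≤ D * (L ^ (2 / ν) / N ^ (4 / ν)) := by
  have hexponents : 2 / ν + (ν - 2) / ν = 1 := by field_simp; ring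
  rw [← mul_div_assoc, div_le_div_iff₀ hP (by positivity)]
  calc L * N ^ (4 / ν) = L ^ (2 / ν) * (N ^ (4 / ν) * L ^ ((ν - 2) / ν)) := by
        rw [mul_left_comm, ← Real.rpow_add hL, hexponents, Real.rpow_one, mul_comm]
    _ ≤ L ^ (2 / ν) * (D * P) := by gcongr
    _ = D * L ^ (2 / ν) * P := by ring

theorem sq_mul_mul_sqrt_rpow_le (hν : 0 < ν) (hN : 0 < N) (hL : 0 < L) (hP : 0 < P)
    (hD : 0 ≤ D) (h : N ^ (4 / ν) * L ^ ((ν - 2) / ν) ≤ D * P) :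
    N ^ 2 * (P * √(P * L) ^ (-(2 + ν))) ≤ D ^ (ν / 2) * L ^ (-ν) := by
  have hsqrt : P * √(P * L) ^ (-(2 + ν)) = P ^ (-(ν / 2)) * (L ^ (ν / 2 - 1) * L ^ (-ν)) := by
    rw [Real.sqrt_eq_rpow, ← Real.rpow_mul (by positivity), Real.mul_rpow hP.le hL.le,
      ← mul_assoc, ← Real.rpow_add hL]
    nth_rewrite 1 [← Real.rpow_one P]
    rw [← Real.rpow_add hP]
    ring_nf
  have hpow : N ^ 2 * L ^ (ν / 2 - 1) ≤ D ^ (ν / 2) * P ^ (ν / 2) := by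
    calc N ^ 2 * L ^ (ν / 2 - 1) = (N ^ (4 / ν) * L ^ ((ν - 2) / ν)) ^ (ν / 2) := by
          rw [Real.mul_rpow (by positivity) (by positivity), ← Real.rpow_mul hN.le,
            ← Real.rpow_mul hL.le, ← Real.rpow_natCast]
          congr 2 <;> field_simp
          norm_num
      _ ≤ (D * P) ^ (ν / 2) := Real.rpow_le_rpow (by positivity) h (by positivity)
      _ = D ^ (ν / 2) * P ^ (ν / 2) := Real.mul_rpow hD hP.le
  have hcancel : P ^ (-(ν / 2)) * P ^ (ν / 2) = 1 := by rw [← Real.rpow_add hP]; simp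
  calc N ^ 2 * (P * √(P * L) ^ (-(2 + ν))) =
        P ^ (-(ν / 2)) * (N ^ 2 * L ^ (ν / 2 - 1)) * L ^ (-ν) := by rw [hsqrt]; ring
    _ ≤ P ^ (-(ν / 2)) * (D ^ (ν / 2) * P ^ (ν / 2)) * L ^ (-ν) := by gcongr
    _ = (P ^ (-(ν / 2)) * P ^ (ν / 2)) * (D ^ (ν / 2) * L ^ (-ν)) := by ring
    _ = _ := by rw [hcancel, one_mul]

theorem fukNagaevBound_sqrt_log_le {n : ℕ} (hn : n ≠ 0) (hP : 0 < P) (hK : 0 ≤ K)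
    (hψ : n * (P * √(P * Real.log n) ^ (-q)) ≤ 1) (hb : Real.exp q * (1 + K) + 3 ≤ b) :
    fukNagaevBound q K P √(Real.log n / P) √(P * Real.log n) (b * √(P * Real.log n)) ≤
      K * (P * √(P * Real.log n) ^ (-q)) + Real.exp K * (n : ℝ)⁻¹ ^ 3 := by
  have : 0 ≤ Real.log n := Real.log_natCast_nonneg n
  have hexp : Real.exp (Real.log n) = n := Real.exp_log (by positivity)
  have hcube : (n : ℝ)⁻¹ ^ 3 = Real.exp (-3 * Real.log n) := by
    rw [← hexp, ← Real.exp_neg, ← Real.exp_nat_mul, Real.log_exp]; congr 1; push_cast; ring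
  have hsq : √(Real.log n / P) ^ 2 * P = Real.log n := by
    rw [Real.sq_sqrt (by positivity)]; field_simp
  have hmul : √(Real.log n / P) * √(P * Real.log n) = Real.log n := by
    rw [← mul_sqrt_div_eq_sqrt_mul hP]; linarith
  unfold fukNagaevBound
  rw [hcube, ← Real.exp_add, hmul, hexp]
  refine add_le_add (by linarith) (Real.exp_le_exp.2 ?_)
  generalize √(P * Real.log n) ^ (-q) = ψ at *
  calc -√(Real.log n / P) * (b * √(P * Real.log n)) +
          P * (Real.exp q * √(Real.log n / P) ^ 2 * (1 + K) + ψ * n * K)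
      = -b * (√(Real.log n / P) * √(P * Real.log n)) +
          Real.exp q * (1 + K) * (√(Real.log n / P) ^ 2 * P) + n * (P * ψ) * K := by ring
    _ = (Real.exp q * (1 + K) - b) * Real.log n + n * (P * ψ) * K := by rw [hmul, hsq]; ring
    _ ≤ -3 * Real.log n + 1 * K := by gcongr; linarith
    _ = K + -3 * Real.log n := by ring

variable {p : ℕ → ℝ}

theorem exists_eventually_rpow_mul_log_rpow_le (hp : ∀ n, 0 < p n)
    (hrate : (fun n : ℕ => (n : ℝ) ^ (4 / ν) * Real.log n ^ ((ν - 2) / ν) / p n)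
      =O[atTop] fun _ => (1 : ℝ)) :
    ∃ D > 0, ∀ᶠ n : ℕ in atTop, 0 < Real.log n ∧
      (n : ℝ) ^ (4 / ν) * Real.log n ^ ((ν - 2) / ν) ≤ D * p n := by
  obtain ⟨D, hD, hbound⟩ := hrate.exists_pos
  refine ⟨D, hD, ?_⟩
  filter_upwards [hbound.bound, (Real.tendsto_log_atTop.comp
    tendsto_natCast_atTop_atTop).eventually_gt_atTop 0] with n hle hlog
  rw [norm_one, mul_one] at hle
  exact ⟨hlog, (div_le_iff₀ (hp n)).1 ((le_abs_self _).trans hle)⟩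

theorem tendsto_sqrt_log_div (hν : 0 < ν) (hp : ∀ n, 0 < p n)
    (hrate : (fun n : ℕ => (n : ℝ) ^ (4 / ν) * Real.log n ^ ((ν - 2) / ν) / p n)
      =O[atTop] fun _ => (1 : ℝ)) :
    Tendsto (fun n : ℕ => √(Real.log n / p n)) atTop (𝓝 0) := by
  obtain ⟨D, -, hev⟩ := exists_eventually_rpow_mul_log_rpow_le hp hrate
  have hlim : Tendsto (fun n : ℕ => D * (Real.log n ^ (2 / ν) / (n : ℝ) ^ (4 / ν))) atTop
      (𝓝 (D * 0)) :=
    ((isLittleO_log_rpow_rpow_atTop (2 / ν) (s := 4 / ν)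
      (by positivity)).tendsto_div_nhds_zero.comp tendsto_natCast_atTop_atTop).const_mul D
  rw [mul_zero] at hlim
  rw [← Real.sqrt_zero]
  refine (squeeze_zero' ?_ ?_ hlim).sqrt
  · filter_upwards [hev] with n h
    exact div_nonneg h.1.le (hp n).le
  · filter_upwards [hev, eventually_gt_atTop 0] with n h hn
    exact div_le_mul_rpow_div_rpow hν (by positivity) h.1 (hp n) h.2

theorem tendsto_sq_mul_mul_sqrt_rpow (hν : 0 < ν) (hp : ∀ n, 0 < p n)
    (hrate : (fun n : ℕ => (n : ℝ) ^ (4 / ν) * Real.log n ^ ((ν - 2) / ν) / p n)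
      =O[atTop] fun _ => (1 : ℝ)) :
    Tendsto (fun n : ℕ => (n : ℝ) ^ 2 * (p n * √(p n * Real.log n) ^ (-(2 + ν)))) atTop
      (𝓝 0) := by
  obtain ⟨D, hD, hev⟩ := exists_eventually_rpow_mul_log_rpow_le hp hrate
  have hlim : Tendsto (fun n : ℕ => D ^ (ν / 2) * Real.log n ^ (-ν)) atTop
      (𝓝 (D ^ (ν / 2) * 0)) :=
    ((tendsto_rpow_neg_atTop hν).comp (Real.tendsto_log_atTop.comp
      tendsto_natCast_atTop_atTop)).const_mul _
  rw [mul_zero] at hlim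
  refine squeeze_zero' (Eventually.of_forall fun n => ?_) ?_ hlim
  · have := hp n
    positivity
  · filter_upwards [hev, eventually_gt_atTop 0] with n h hn
    exact sq_mul_mul_sqrt_rpow_le hν (by positivity) h.1 (hp n) hD.le h.2

theorem tendsto_sq_mul_fukNagaevBound (hν : 0 < ν) (hp : ∀ n, 0 < p n)
    (hrate : (fun n : ℕ => (n : ℝ) ^ (4 / ν) * Real.log n ^ ((ν - 2) / ν) / p n)
      =O[atTop] fun _ => (1 : ℝ)) (hK : 0 ≤ K) (hb : Real.exp (2 + ν) * (1 + K) + 3 ≤ b) :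
    Tendsto (fun n : ℕ => (n : ℝ) ^ 2 * fukNagaevBound (2 + ν) K (p n) √(Real.log n / p n)
      √(p n * Real.log n) (b * √(p n * Real.log n))) atTop (𝓝 0) := by
  have hψ := tendsto_sq_mul_mul_sqrt_rpow hν hp hrate
  have hlim := (hψ.const_mul K).add
    ((tendsto_inv_atTop_zero.comp tendsto_natCast_atTop_atTop).const_mul (Real.exp K))
  rw [mul_zero, mul_zero, add_zero] at hlim
  refine squeeze_zero' (Eventually.of_forall fun n => ?_) ?_ hlim
  · have := hp n
    unfold fukNagaevBound
    positivity
  filter_upwards [eventually_gt_atTop 0, hψ.eventually_le_const one_pos] with n hn hψ1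
  have hψn : n * (p n * √(p n * Real.log n) ^ (-(2 + ν))) ≤ 1 := by
    have := hp n
    refine le_trans ?_ hψ1
    gcongr
    exact_mod_cast Nat.le_self_pow two_ne_zero n
  calc (n : ℝ) ^ 2 * fukNagaevBound (2 + ν) K (p n) √(Real.log n / p n)
          √(p n * Real.log n) (b * √(p n * Real.log n))
      ≤ (n : ℝ) ^ 2 * (K * (p n * √(p n * Real.log n) ^ (-(2 + ν))) +
          Real.exp K * (n : ℝ)⁻¹ ^ 3) := by
        gcongr
        exact fukNagaevBound_sqrt_log_le hn.ne' (hp n) hK hψn hb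
    _ = K * ((n : ℝ) ^ 2 * (p n * √(p n * Real.log n) ^ (-(2 + ν)))) +
          Real.exp K * (n : ℝ)⁻¹ := by field_simp

end Rate

/-! ### Conditional laws of conditionally independent families -/

section CondLaw

variable {Ω β ι : Type*} [MeasurableSpace Ω] [mβ : MeasurableSpace β] [Fintype ι]
  {μ : Measure Ω} [IsProbabilityMeasure μ] {X : Ω → β} {U : ι → Ω → ℝ} {q K : ℝ}

/-- A regular version of the conditional distribution of the family `U` given `X`. -/
noncomputable abbrev condLaw (μ : Measure Ω) [IsProbabilityMeasure μ] (X : Ω → β) (U : ι → Ω → ℝ) :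
    Kernel β (ι → ℝ) :=
  condDistrib (fun ω i => U i ω) X μ

theorem CondIndepFamily.ae_condLaw_pi_eq_prod (hind : CondIndepFamily μ (mβ.comap X) U)
    (hX : Measurable X) (hU : ∀ i, Measurable (U i)) {B : ι → Set ℝ}
    (hB : ∀ i, MeasurableSet (B i)) :
    ∀ᵐ ω ∂μ, condLaw μ X U (X ω) (Set.univ.pi B) =
      ∏ i, (condLaw μ X U (X ω)).map (fun z => z i) (B i) := by
  have hUm : Measurable fun ω i => U i ω := measurable_pi_lambda _ hU
  have heval : ∀ i, MeasurableSet ((fun z : ι → ℝ => z i) ⁻¹' B i) :=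
    fun i => measurable_pi_apply i (hB i)
  have hpreimage : (fun ω i => U i ω) ⁻¹' Set.univ.pi B = ⋂ i ∈ Finset.univ, U i ⁻¹' B i := by
    ext; simp
  filter_upwards [condDistrib_ae_eq_condExp hX hUm (MeasurableSet.univ_pi hB),
    ae_all_iff.2 fun i => condDistrib_ae_eq_condExp hX hUm (heval i),
    hind Finset.univ B fun i _ => hB i] with ω hjoint hmarginal hprod
  rw [hpreimage, hprod, Finset.prod_apply] at hjoint
  rw [← ENNReal.toReal_eq_toReal_iff' (measure_ne_top _ _)
    (ENNReal.prod_ne_top fun i _ => measure_ne_top _ _), ENNReal.toReal_prod]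
  refine hjoint.trans (Finset.prod_congr rfl fun i _ => ?_)
  rw [Measure.map_apply (measurable_pi_apply i) (hB i)]
  exact (hmarginal i).symm

theorem CondIndepFamily.ae_iIndepFun_condLaw (hind : CondIndepFamily μ (mβ.comap X) U)
    (hX : Measurable X) (hU : ∀ i, Measurable (U i)) :
    ∀ᵐ ω ∂μ, iIndepFun (fun i (z : ι → ℝ) => z i) (condLaw μ X U (X ω)) := by
  have hboxes : ∀ᵐ ω ∂μ, ∀ ab : ι → ℚ × ℚ,
      condLaw μ X U (X ω) (Set.univ.pi fun i => Set.Ioo ((ab i).1 : ℝ) (ab i).2) =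
        ∏ i, (condLaw μ X U (X ω)).map (fun z => z i) (Set.Ioo ((ab i).1 : ℝ) (ab i).2) :=
    ae_all_iff.2 fun ab => hind.ae_condLaw_pi_eq_prod hX hU fun i => measurableSet_Ioo
  filter_upwards [hboxes] with ω hω
  have : ∀ i, IsProbabilityMeasure ((condLaw μ X U (X ω)).map fun z => z i) := fun i =>
    Measure.isProbabilityMeasure_map (measurable_pi_apply i).aemeasurable
  rw [iIndepFun_iff_map_fun_eq_pi_map fun i => (measurable_pi_apply i).aemeasurable]
  refine Measure.map_id.trans (Measure.pi_eq_generateFrom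
    (fun _ => Real.borel_eq_generateFrom_Ioo_rat.symm) (fun _ => Real.isPiSystem_Ioo_rat)
    (fun _ => Real.finiteSpanningSetsInIooRat _) fun s hs => ?_).symm
  simp only [Set.mem_iUnion, Set.mem_singleton_iff] at hs
  choose a b _ hs using hs
  obtain rfl : s = fun i => Set.Ioo (a i : ℝ) (b i) := funext hs
  exact hω fun i => (a i, b i)

theorem measure_le_of_ae_condLaw_le (hX : Measurable X) (hU : ∀ i, Measurable (U i))
    {T : Set (β × (ι → ℝ))} (hT : MeasurableSet T) {B : ℝ≥0∞}
    (hB : ∀ᵐ ω ∂μ, condLaw μ X U (X ω) (Prod.mk (X ω) ⁻¹' T) ≤ B) :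
    μ {ω | (X ω, fun i => U i ω) ∈ T} ≤ B := by
  have hUm : Measurable fun ω i => U i ω := measurable_pi_lambda _ hU
  calc μ {ω | (X ω, fun i => U i ω) ∈ T}
      = ∫⁻ ω, condLaw μ X U (X ω) (Prod.mk (X ω) ⁻¹' T) ∂μ := by
        rw [← lintegral_map (f := fun b => condLaw μ X U b (Prod.mk b ⁻¹' T))
          (Kernel.measurable_kernel_prodMk_left hT) hX, ← Measure.compProd_apply hT,
          compProd_map_condDistrib hUm.aemeasurable, Measure.map_apply (hX.prodMk hUm) hT]
        rfl
    _ ≤ ∫⁻ _, B ∂μ := lintegral_mono_ae hB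
    _ = B := by simp

theorem ae_lintegral_condLaw_eq_condLExp (hX : Measurable X) (hU : ∀ i, Measurable (U i)) (i : ι)
    {f : ℝ → ℝ≥0∞} (hf : Measurable f) :
    ∀ᵐ ω ∂μ, ∫⁻ z, f (z i) ∂condLaw μ X U (X ω) =
      condLExp (mβ.comap X) μ (fun ω => f (U i ω)) ω := by
  have hUm : Measurable fun ω i => U i ω := measurable_pi_lambda _ hU
  have hfi : Measurable fun z : ι → ℝ => f (z i) := hf.comp (measurable_pi_apply i)
  refine ae_eq_condLExp (hm := hX.comap_le) μ _
    (hfi.lintegral_kernel.comp (Measurable.of_comap_le le_rfl)) ?_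
  rintro _ ⟨t, ht, rfl⟩
  have hfubini := Measure.setLIntegral_compProd (μ := μ.map X) (κ := condLaw μ X U)
    (hfi.comp measurable_snd) ht MeasurableSet.univ
  rw [compProd_map_condDistrib hUm.aemeasurable, setLIntegral_map (ht.prod MeasurableSet.univ)
    (hfi.comp measurable_snd) (hX.prodMk hUm), Set.mk_preimage_prod, Set.preimage_univ,
    Set.inter_univ] at hfubini
  simp only [Measure.restrict_univ, Function.comp_def] at hfubini
  rw [setLIntegral_map ht hfi.lintegral_kernel hX] at hfubini
  exact hfubini.symm

theorem ae_integral_condLaw_eq_zero (hX : Measurable X) (hU : ∀ i, Measurable (U i)) {i : ι}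
    (hint : Integrable (U i) μ) (hmean : μ[U i | mβ.comap X] =ᵐ[μ] 0) :
    ∀ᵐ ω ∂μ, ∫ z, z i ∂condLaw μ X U (X ω) = 0 := by
  filter_upwards [condExp_ae_eq_integral_condDistrib hX (measurable_pi_lambda _ hU).aemeasurable
    (measurable_pi_apply i).stronglyMeasurable hint, hmean] with ω hcond hzero
  exact hcond.symm.trans hzero

/-- The values of `X` given which all the `U i` have conditional absolute moments of order `q` at
most `K`; the conditional law is fixed to be `condLaw`. -/
def momentSet (μ : Measure Ω) [IsProbabilityMeasure μ] (X : Ω → β) (U : ι → Ω → ℝ) (q K : ℝ) :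
    Set β :=
  {b | ∀ i, ∫⁻ z, ENNReal.ofReal (|z i| ^ q) ∂condLaw μ X U b ≤ ENNReal.ofReal K}

theorem measurableSet_momentSet (q K : ℝ) : MeasurableSet (momentSet μ X U q K) := by
  simp only [momentSet, Set.ofPred_forall]
  exact MeasurableSet.iInter fun i =>
    measurableSet_le (Measurable.lintegral_kernel (by fun_prop)) measurable_const

theorem CondIndepFamily.ae_indepCentered_condLaw (hind : CondIndepFamily μ (mβ.comap X) U)
    (hX : Measurable X) (hU : ∀ i, Measurable (U i)) (hint : ∀ i, Integrable (U i) μ)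
    (hmean : ∀ i, μ[U i | mβ.comap X] =ᵐ[μ] 0) (hK : 0 ≤ K) :
    ∀ᵐ ω ∂μ, X ω ∈ momentSet μ X U q K →
      IndepCentered (fun i (z : ι → ℝ) => z i) (condLaw μ X U (X ω)) q K := by
  filter_upwards [hind.ae_iIndepFun_condLaw hX hU,
    ae_all_iff.2 fun i => ae_integral_condLaw_eq_zero hX hU (hint i) (hmean i)]
    with ω hindep hzero hmoment
  have hintegrable : ∀ i, Integrable (fun z : ι → ℝ => |z i| ^ q) (condLaw μ X U (X ω)) := by
    refine fun i => ⟨(by fun_prop : Measurable fun z : ι → ℝ => |z i| ^ q).aestronglyMeasurable, ?_⟩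
    rw [hasFiniteIntegral_iff_ofReal (Eventually.of_forall fun z => by positivity)]
    exact (hmoment i).trans_lt ENNReal.ofReal_lt_top
  refine ⟨hindep, measurable_pi_apply, hzero, hintegrable, fun i => ?_⟩
  rw [integral_eq_lintegral_of_nonneg_ae (Eventually.of_forall fun z => by positivity)
    (hintegrable i).aestronglyMeasurable]
  exact ENNReal.toReal_le_of_le_ofReal hK (hmoment i)

end CondLaw

/-! ### The pseudo-max distance -/

section PseudoMaxDist

variable {n : ℕ} {ι : Type} [Fintype ι] {v w : Fin n → EuclideanSpace ℝ ι} {i j l : Fin n} {B : ℝ}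

theorem pseudoMaxDist_nonneg (v : Fin n → EuclideanSpace ℝ ι) (i j : Fin n) :
    0 ≤ pseudoMaxDist n ι v i j :=
  Real.iSup_nonneg fun l => by positivity

theorem pseudoMaxDist_le (hB : 0 ≤ B)
    (h : ∀ l, l ≠ i → l ≠ j → |inner ℝ (v i - v j) (v l)| / (Fintype.card ι : ℝ) ≤ B) :
    pseudoMaxDist n ι v i j ≤ B :=
  Real.iSup_le (fun l => h l l.2.1 l.2.2) hB

theorem le_pseudoMaxDist (v : Fin n → EuclideanSpace ℝ ι) (hi : l ≠ i) (hj : l ≠ j) :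
    |inner ℝ (v i - v j) (v l)| / (Fintype.card ι : ℝ) ≤ pseudoMaxDist n ι v i j :=
  le_ciSup (f := fun l : {l : Fin n // l ≠ i ∧ l ≠ j} =>
    |inner ℝ (v i - v j) (v l)| / (Fintype.card ι : ℝ)) (Set.finite_range _).bddAbove ⟨l, hi, hj⟩

theorem pseudoMaxDist_le_add (hB : 0 ≤ B) (h : ∀ l, l ≠ i → l ≠ j →
    |inner ℝ (v i - v j) (v l) - inner ℝ (w i - w j) (w l)| / (Fintype.card ι : ℝ) ≤ B) :
    pseudoMaxDist n ι v i j ≤ pseudoMaxDist n ι w i j + B := by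
  refine pseudoMaxDist_le (add_nonneg (pseudoMaxDist_nonneg w i j) hB) fun l hi hj => ?_
  calc |inner ℝ (v i - v j) (v l)| / (Fintype.card ι : ℝ)
      ≤ (|inner ℝ (w i - w j) (w l)| + |inner ℝ (v i - v j) (v l) - inner ℝ (w i - w j) (w l)|) /
          (Fintype.card ι : ℝ) := by
        gcongr
        linarith [abs_sub_abs_le_abs_sub (inner ℝ (v i - v j) (v l)) (inner ℝ (w i - w j) (w l))]
    _ ≤ pseudoMaxDist n ι w i j + B := by
        rw [add_div]
        exact add_le_add (le_pseudoMaxDist w hi hj) (h l hi hj)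

theorem abs_pseudoMaxDist_sub_le (hB : 0 ≤ B) (h : ∀ l, l ≠ i → l ≠ j →
    |inner ℝ (v i - v j) (v l) - inner ℝ (w i - w j) (w l)| / (Fintype.card ι : ℝ) ≤ B) :
    |pseudoMaxDist n ι v i j - pseudoMaxDist n ι w i j| ≤ B := by
  rw [abs_sub_le_iff, sub_le_iff_le_add', sub_le_iff_le_add']
  exact ⟨pseudoMaxDist_le_add hB h,
    pseudoMaxDist_le_add hB fun l hi hj => by rw [abs_sub_comm]; exact h l hi hj⟩

theorem measurable_pseudoMaxDist {Ω : Type*} [MeasurableSpace Ω]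
    {v : Ω → Fin n → EuclideanSpace ℝ ι} (hv : ∀ l, Measurable fun ω => v ω l) (i j : Fin n) :
    Measurable fun ω => pseudoMaxDist n ι (v ω) i j :=
  Measurable.iSup fun l => by fun_prop

theorem abs_inner_add_sub_inner_le {V κ : Type*} [NormedAddCommGroup V] [InnerProductSpace ℝ V]
    {v z : κ → V} {x : ℝ} (hlin : ∀ i l, |inner ℝ (z i) (v l)| ≤ x)
    (hquad : ∀ i l, i ≠ l → |inner ℝ (z i) (z l)| ≤ x) {i j l : κ} (hi : l ≠ i) (hj : l ≠ j) :
    |inner ℝ ((v i + z i) - (v j + z j)) (v l + z l) - inner ℝ (v i - v j) (v l)| ≤ 6 * x := by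
  have hexpand : inner ℝ ((v i + z i) - (v j + z j)) (v l + z l) - inner ℝ (v i - v j) (v l) =
      inner ℝ (z i) (v l) - inner ℝ (z j) (v l) + inner ℝ (z l) (v i) - inner ℝ (z l) (v j) +
        inner ℝ (z i) (z l) - inner ℝ (z j) (z l) := by
    simp only [inner_sub_left, inner_add_left, inner_add_right]
    rw [real_inner_comm (v i) (z l), real_inner_comm (v j) (z l)]
    ring
  have h₁ := abs_le.1 (hlin i l)
  have h₂ := abs_le.1 (hlin j l)
  have h₃ := abs_le.1 (hlin l i)
  have h₄ := abs_le.1 (hlin l j)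
  have h₅ := abs_le.1 (hquad i l hi.symm)
  have h₆ := abs_le.1 (hquad j l hj.symm)
  rw [hexpand, abs_le]
  constructor <;> linarith

theorem abs_pseudoMaxDist_add_sub_lt {z : Fin n → EuclideanSpace ℝ ι} {x : ℝ}
    (hlin : ∀ i l, |inner ℝ (z i) (v l)| < x) (hquad : ∀ i l, i ≠ l → |inner ℝ (z i) (z l)| < x)
    (hxB : 6 * x < B * (Fintype.card ι : ℝ)) (i j : Fin n) :
    |pseudoMaxDist n ι (v + z) i j - pseudoMaxDist n ι v i j| < B := by
  have hx : 0 < x := (abs_nonneg _).trans_lt (hlin i j)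
  have hcard : (0 : ℝ) < Fintype.card ι := by
    refine lt_of_le_of_ne (by positivity) fun h => ?_
    rw [← h] at hxB
    linarith
  refine lt_of_le_of_lt (abs_pseudoMaxDist_sub_le (by positivity) fun l hi hj => ?_)
    ((div_lt_iff₀ hcard).2 hxB)
  gcongr
  exact abs_inner_add_sub_inner_le (fun i l => (hlin i l).le) (fun i l h => (hquad i l h).le) hi hj

section Noise

variable {Ω : Type*} [MeasurableSpace Ω] {P : Measure Ω} {z : Fin n × ι → Ω → ℝ}
  {q K K' C t x y : ℝ}

theorem IndepCentered.measureReal_le_abs_inner_le (h : IndepCentered z P q K) (hq : 2 ≤ q)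
    (hC : ∀ s, |v l s| ≤ C) (hKC : K * C ^ q ≤ K') (ht : 0 < t) (hy : 0 < y) (i : Fin n) :
    P.real {ω | x ≤ |inner ℝ (WithLp.toLp 2 fun s => z (i, s) ω) (v l)|} ≤
      2 * fukNagaevBound q K' (Fintype.card ι) t y x := by
  simpa [PiLp.inner_apply, mul_comm] using (((h.precomp (Prod.mk_right_injective i)).mul_const
    (by linarith) hC).mono hKC).measureReal_le_abs_sum_le hq ht hy x

theorem IndepCentered.measureReal_le_abs_inner_self_le (h : IndepCentered z P q K) (hq : 2 ≤ q)
    (hKK : K * K ≤ K') (ht : 0 < t) (hy : 0 < y) (hil : i ≠ l) :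
    P.real {ω | x ≤ |inner ℝ (WithLp.toLp 2 fun s => z (i, s) ω)
      (WithLp.toLp 2 fun s => z (l, s) ω)|} ≤ 2 * fukNagaevBound q K' (Fintype.card ι) t y x := by
  have hinj : Function.Injective (Sum.elim (fun s : ι => (i, s)) fun s => (l, s)) :=
    (Prod.mk_right_injective i).sumElim (Prod.mk_right_injective l) (by simp [hil])
  simpa [PiLp.inner_apply, mul_comm] using
    ((h.mul hinj).mono hKK).measureReal_le_abs_sum_le hq ht hy x

theorem IndepCentered.measureReal_le_abs_pseudoMaxDist_sub_le (h : IndepCentered z P q K)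
    (hq : 2 ≤ q) (hv : ∀ l s, |v l s| ≤ C) (hKC : K * C ^ q ≤ K') (hKK : K * K ≤ K') (ht : 0 < t)
    (hy : 0 < y) (hxB : 6 * x < B * (Fintype.card ι : ℝ)) :
    P.real {ω | ∃ i j, B ≤ |pseudoMaxDist n ι (v + fun i => WithLp.toLp 2 fun s => z (i, s) ω) i j -
      pseudoMaxDist n ι v i j|} ≤
      4 * ((n : ℝ) ^ 2 * fukNagaevBound q K' (Fintype.card ι) t y x) := by
  have := h.isProbabilityMeasure
  set Z : Ω → Fin n → EuclideanSpace ℝ ι := fun ω i => WithLp.toLp 2 fun s => z (i, s) ω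
  set L : Fin n × Fin n → Set Ω := fun a => {ω | x ≤ |inner ℝ (Z ω a.1) (v a.2)|}
  set Q : Fin n × Fin n → Set Ω := fun a => {ω | a.1 ≠ a.2 ∧ x ≤ |inner ℝ (Z ω a.1) (Z ω a.2)|}
  have hcover : {ω | ∃ i j, B ≤ |pseudoMaxDist n ι (v + Z ω) i j - pseudoMaxDist n ι v i j|} ⊆
      ⋃ a, L a ∪ Q a := by
    rintro ω ⟨i, j, hij⟩
    contrapose! hij
    simp only [L, Q, Set.mem_iUnion, Set.mem_union, Set.mem_ofPred_eq, not_exists, not_or, not_and,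
      not_le, Prod.forall] at hij
    exact abs_pseudoMaxDist_add_sub_lt (fun i l => (hij i l).1) (fun i l => (hij i l).2) hxB i j
  have hLQ : ∀ a, P.real (L a ∪ Q a) ≤ 4 * fukNagaevBound q K' (Fintype.card ι) t y x := by
    intro a
    have hL : P.real (L a) ≤ 2 * fukNagaevBound q K' (Fintype.card ι) t y x :=
      h.measureReal_le_abs_inner_le hq (hv a.2) hKC ht hy a.1
    have hQ : P.real (Q a) ≤ 2 * fukNagaevBound q K' (Fintype.card ι) t y x := by
      by_cases ha : a.1 = a.2
      · simpa [Q, ha] using measureReal_nonneg.trans hL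
      · simpa [Q, ha] using h.measureReal_le_abs_inner_self_le hq hKK ht hy ha
    linarith [measureReal_union_le (μ := P) (L a) (Q a)]
  calc _ ≤ P.real (⋃ a, L a ∪ Q a) := measureReal_mono hcover
    _ ≤ ∑ a, P.real (L a ∪ Q a) := measureReal_iUnion_fintype_le _
    _ ≤ ∑ _a : Fin n × Fin n, 4 * fukNagaevBound q K' (Fintype.card ι) t y x :=
        Finset.sum_le_sum fun a _ => hLQ a
    _ = _ := by simp; ring

end Noise

end PseudoMaxDist

/-! ### Stochastic orders and events of probability tending to one -/

section Stochastic

variable {Ω : Type*} [MeasurableSpace Ω] {μ : Measure Ω} {X Y : ℕ → Ω → ℝ} {E E' : ℕ → Set Ω}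

theorem StochLE.of_forall_eventually_le (h : ∀ δ : ℝ≥0∞, 0 < δ → ∀ᶠ ε : ℝ in atTop,
    ∀ᶠ n in atTop, μ {ω | ε * |Y n ω| ≤ |X n ω|} ≤ δ) : StochLE μ X Y := by
  refine nonpos_iff_eq_zero.1 (le_of_forall_pos_le_add fun δ hδ => ?_)
  rw [zero_add]
  refine limsup_le_of_le (by isBoundedDefault) ?_
  filter_upwards [h δ hδ] with ε hε
  exact limsup_le_of_le (by isBoundedDefault) hε

theorem StochLE.one_right_of_ae_abs_le {C : ℝ} (h : ∀ n, ∀ᵐ ω ∂μ, |X n ω| ≤ C) :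
    StochLE μ X fun _ _ => 1 := by
  refine .of_forall_eventually_le fun δ _ => ?_
  filter_upwards [eventually_gt_atTop C] with ε hε
  refine Eventually.of_forall fun n => le_of_eq_of_le ?_ (zero_le (a := δ))
  refine measure_eq_zero_iff_ae_notMem.2 ?_
  filter_upwards [h n] with ω hω
  rw [abs_one, mul_one, not_le]
  exact hω.trans_lt hε

theorem StochLE.one_left_of_forall_exists_measure_lt_le
    (h : ∀ δ : ℝ≥0∞, 0 < δ → ∃ c > 0, ∀ᶠ n in atTop, μ {ω | Y n ω < c} ≤ δ) :
    StochLE μ (fun _ _ => 1) Y := by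
  refine .of_forall_eventually_le fun δ hδ => ?_
  obtain ⟨c, hc, hn⟩ := h δ hδ
  filter_upwards [eventually_gt_atTop c⁻¹] with ε hε
  filter_upwards [hn] with n hn
  refine (measure_mono fun ω hω => ?_).trans hn
  contrapose! hω
  have hYc : c ≤ Y n ω := not_lt.1 hω
  simp only [Set.mem_ofPred_eq, abs_one, not_le]
  calc 1 = c⁻¹ * c := (inv_mul_cancel₀ hc.ne').symm
    _ < ε * c := by gcongr
    _ ≤ ε * |Y n ω| := by
        gcongr
        · exact (inv_pos.2 hc).le.trans hε.le
        · exact hYc.trans (le_abs_self _)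

theorem ProbTendsToOne.mono_ae (hE : ProbTendsToOne μ E)
    (h : ∀ᶠ n in atTop, ∀ᵐ ω ∂μ, ω ∈ E n → ω ∈ E' n) : ProbTendsToOne μ E' := by
  refine tendsto_of_tendsto_of_tendsto_of_le_of_le' tendsto_const_nhds hE
    (Eventually.of_forall fun _ => zero_le) ?_
  filter_upwards [h] with n hn
  refine measure_mono_ae ?_
  filter_upwards [hn] with ω hω
  exact mt hω

theorem ProbTendsToOne.inter (hE : ProbTendsToOne μ E) (hE' : ProbTendsToOne μ E') :
    ProbTendsToOne μ fun n => E n ∩ E' n := by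
  refine tendsto_of_tendsto_of_tendsto_of_le_of_le tendsto_const_nhds
    (by simpa using Tendsto.add hE hE') (fun _ => zero_le) fun n => ?_
  simp only [Set.compl_inter]
  exact measure_union_le _ _

theorem ProbTendsToOne.biInter_finset {κ : Type*} {S : Finset κ} {E : κ → ℕ → Set Ω}
    (hE : ∀ k ∈ S, ProbTendsToOne μ (E k)) : ProbTendsToOne μ fun n => ⋂ k ∈ S, E k n := by
  refine tendsto_of_tendsto_of_tendsto_of_le_of_le tendsto_const_nhds
    (by simpa using tendsto_finsetSum S hE) (fun _ => zero_le) fun n => ?_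
  simp only [Set.compl_iInter]
  exact measure_biUnion_finset_le _ _

theorem tendsto_measure_natCast_lt [IsFiniteMeasure μ] {S : Ω → ℝ≥0∞} (hS : Measurable S)
    (hfin : ∀ᵐ ω ∂μ, S ω < ∞) :
    Tendsto (fun k : ℕ => μ {ω | (k : ℝ≥0∞) < S ω}) atTop (𝓝 0) := by
  have hzero : μ (⋂ k : ℕ, {ω | (k : ℝ≥0∞) < S ω}) = 0 := by
    refine measure_eq_zero_iff_ae_notMem.2 ?_
    filter_upwards [hfin] with ω hω hmem
    obtain ⟨k, hk⟩ := ENNReal.exists_nat_gt hω.ne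
    exact (Set.mem_iInter.1 hmem k : (k : ℝ≥0∞) < S ω).not_gt hk
  rw [← hzero]
  exact tendsto_measure_iInter_atTop
    (fun k => (measurableSet_lt measurable_const hS).nullMeasurableSet)
    (fun a b hab ω (hω : (b : ℝ≥0∞) < S ω) => (Nat.cast_le.2 hab).trans_lt hω)
    ⟨0, measure_ne_top _ _⟩

end Stochastic

section Independent

variable {Ω E : Type*} [MeasurableSpace Ω] [MeasurableSpace E] {μ : Measure Ω} {B : Set E} {θ : ℝ}

theorem measureReal_forall_notMem_le {κ : Type*} {Y : κ → Ω → E} (hind : iIndepFun Y μ)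
    (hY : ∀ l, Measurable (Y l)) (hB : MeasurableSet B) (hθ : ∀ l, θ ≤ μ.real (Y l ⁻¹' B))
    (S : Finset κ) : μ.real {ω | ∀ l ∈ S, Y l ω ∉ B} ≤ Real.exp (-θ) ^ S.card := by
  have := hind.isProbabilityMeasure
  have hset : {ω | ∀ l ∈ S, Y l ω ∉ B} = ⋂ l ∈ S, Y l ⁻¹' Bᶜ := by ext; simp
  rw [hset, measureReal_def, hind.measure_inter_preimage_eq_mul S fun l _ => hB.compl,
    ENNReal.toReal_prod, ← Finset.prod_const]
  refine Finset.prod_le_prod (fun l _ => ENNReal.toReal_nonneg) fun l _ => ?_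
  calc μ.real (Y l ⁻¹' Bᶜ) = 1 - μ.real (Y l ⁻¹' B) := by
        rw [Set.preimage_compl, probReal_compl_eq_one_sub (hY l hB)]
    _ ≤ 1 - θ := by linarith [hθ l]
    _ ≤ Real.exp (-θ) := Real.one_sub_le_exp_neg θ

theorem measureReal_exists_pair_forall_notMem_le {n : ℕ} {Y : Fin n → Ω → E}
    (hind : iIndepFun Y μ) (hY : ∀ l, Measurable (Y l)) (hB : MeasurableSet B) (hθ0 : 0 ≤ θ)
    (hθ : ∀ l, θ ≤ μ.real (Y l ⁻¹' B)) :
    μ.real {ω | ∃ i j, ∀ l, l ≠ i → l ≠ j → Y l ω ∉ B} ≤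
      (n : ℝ) ^ 2 * Real.exp (-θ) ^ (n - 2) := by
  have := hind.isProbabilityMeasure
  have hpair : ∀ a : Fin n × Fin n, μ.real {ω | ∀ l ∈ (Finset.univ \ {a.1, a.2} : Finset (Fin n)),
      Y l ω ∉ B} ≤ Real.exp (-θ) ^ (n - 2) := by
    intro a
    refine (measureReal_forall_notMem_le hind hY hB hθ _).trans
      (pow_le_pow_of_le_one (Real.exp_pos _).le (Real.exp_le_one_iff.2 (by linarith)) ?_)
    have hcard := Finset.le_card_sdiff ({a.1, a.2} : Finset (Fin n)) Finset.univ
    have htwo : ({a.1, a.2} : Finset (Fin n)).card ≤ 2 := Finset.card_le_two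
    rw [Finset.card_univ, Fintype.card_fin] at hcard
    omega
  calc μ.real {ω | ∃ i j, ∀ l, l ≠ i → l ≠ j → Y l ω ∉ B}
      ≤ μ.real (⋃ a : Fin n × Fin n,
          {ω | ∀ l ∈ (Finset.univ \ {a.1, a.2} : Finset (Fin n)), Y l ω ∉ B}) := by
        refine measureReal_mono ?_
        rintro ω ⟨i, j, hω⟩
        refine Set.mem_iUnion.2 ⟨(i, j), fun l hl => ?_⟩
        rw [Finset.mem_sdiff, Finset.mem_insert, Finset.mem_singleton, not_or] at hl
        exact hω l hl.2.1 hl.2.2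
    _ ≤ ∑ _a : Fin n × Fin n, Real.exp (-θ) ^ (n - 2) :=
        (measureReal_iUnion_fintype_le _).trans (Finset.sum_le_sum fun a _ => hpair a)
    _ = (n : ℝ) ^ 2 * Real.exp (-θ) ^ (n - 2) := by simp [sq]

theorem probTendsToOne_exists_ne_ne_mem [IsProbabilityMeasure μ] {Y : ∀ n, Fin n → Ω → E}
    (hind : ∀ n, iIndepFun (Y n) μ) (hY : ∀ n l, Measurable (Y n l)) (hB : MeasurableSet B)
    (hθ0 : 0 < θ) (hθ : ∀ n l, θ ≤ μ.real (Y n l ⁻¹' B)) :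
    ProbTendsToOne μ fun n => {ω | ∀ i j, ∃ l, l ≠ i ∧ l ≠ j ∧ Y n l ω ∈ B} := by
  set s := Real.exp (-θ)
  have hs0 : 0 < s := Real.exp_pos _
  have hs1 : s < 1 := Real.exp_lt_one_iff.2 (by linarith)
  have hlim : Tendsto (fun n : ℕ => ENNReal.ofReal ((n : ℝ) ^ 2 * s ^ n * (s ^ 2)⁻¹)) atTop
      (𝓝 0) := by
    simpa using ENNReal.tendsto_ofReal ((tendsto_pow_const_mul_const_pow_of_abs_lt_one 2
      (by rwa [abs_of_pos hs0] : |s| < 1)).mul_const (s ^ 2)⁻¹)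
  refine tendsto_of_tendsto_of_tendsto_of_le_of_le' tendsto_const_nhds hlim
    (Eventually.of_forall fun _ => zero_le) ?_
  filter_upwards [eventually_ge_atTop 2] with n hn
  have hcompl : {ω | ∀ i j, ∃ l, l ≠ i ∧ l ≠ j ∧ Y n l ω ∈ B}ᶜ =
      {ω | ∃ i j, ∀ l, l ≠ i → l ≠ j → Y n l ω ∉ B} := by ext; simp
  rw [hcompl, ← ofReal_measureReal, mul_assoc, ← pow_sub₀ s hs0.ne' hn]
  exact ENNReal.ofReal_le_ofReal
    (measureReal_exists_pair_forall_notMem_le (hind n) (hY n) hB hθ0.le (hθ n))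

end Independent

/-! ### Denoising -/

section Denoising

variable {Ω β κ : Type*} {ι : Type} [MeasurableSpace Ω] [mβ : MeasurableSpace β] [Fintype κ]
  [Fintype ι] {μ : Measure Ω} [IsProbabilityMeasure μ] {X : Ω → β} {U : κ → Ω → ℝ} {n : ℕ}
  {h : β → Fin n → EuclideanSpace ℝ ι} {a : Fin n × ι → κ} {q K K' C B t x y : ℝ}

theorem CondIndepFamily.measure_le_abs_pseudoMaxDist_sub_le
    (hind : CondIndepFamily μ (mβ.comap X) U) (hX : Measurable X) (hU : ∀ k, Measurable (U k))
    (hint : ∀ k, Integrable (U k) μ) (hmean : ∀ k, μ[U k | mβ.comap X] =ᵐ[μ] 0) (hK : 0 ≤ K)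
    (hh : ∀ l, Measurable fun b => h b l) (ha : Function.Injective a) (hq : 2 ≤ q)
    (hKC : K * C ^ q ≤ K') (hKK : K * K ≤ K') (ht : 0 < t) (hy : 0 < y)
    (hxB : 6 * x < B * (Fintype.card ι : ℝ)) :
    μ {ω | X ω ∈ momentSet μ X U q K ∧ (∀ l s, |h (X ω) l s| ≤ C) ∧ ∃ i j,
      B ≤ |pseudoMaxDist n ι (h (X ω) + fun i => WithLp.toLp 2 fun s => U (a (i, s)) ω) i j -
        pseudoMaxDist n ι (h (X ω)) i j|} ≤
      ENNReal.ofReal (4 * ((n : ℝ) ^ 2 * fukNagaevBound q K' (Fintype.card ι) t y x)) := by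
  set G : Set β := momentSet μ X U q K
  set Z : (κ → ℝ) → Fin n → EuclideanSpace ℝ ι := fun z i => WithLp.toLp 2 fun s => z (a (i, s))
  set T : Set (β × (κ → ℝ)) := {bz | bz.1 ∈ G ∧ (∀ l s, |h bz.1 l s| ≤ C) ∧ ∃ i j,
    B ≤ |pseudoMaxDist n ι (h bz.1 + Z bz.2) i j - pseudoMaxDist n ι (h bz.1) i j|}
  have hfst : ∀ l, Measurable fun bz : β × (κ → ℝ) => h bz.1 l := fun l =>
    (hh l).comp measurable_fst
  have hsum : ∀ l, Measurable fun bz : β × (κ → ℝ) => (h bz.1 + Z bz.2) l := fun l =>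
    (hfst l).add (by fun_prop)
  have hbdd : MeasurableSet {bz : β × (κ → ℝ) | ∀ l s, |h bz.1 l s| ≤ C} := by
    simp only [Set.ofPred_forall]
    exact .iInter fun l => .iInter fun s =>
      measurableSet_le (by have := hfst l; fun_prop) measurable_const
  have hdev : MeasurableSet {bz : β × (κ → ℝ) | ∃ i j,
      B ≤ |pseudoMaxDist n ι (h bz.1 + Z bz.2) i j - pseudoMaxDist n ι (h bz.1) i j|} := by
    simp only [Set.ofPred_exists]
    exact .iUnion fun i => .iUnion fun j => measurableSet_le measurable_const
      ((measurable_pseudoMaxDist hsum i j).sub (measurable_pseudoMaxDist hfst i j)).abs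
  have hT : MeasurableSet T :=
    ((measurableSet_momentSet q K).preimage measurable_fst).inter (hbdd.inter hdev)
  refine measure_le_of_ae_condLaw_le hX hU hT ?_
  filter_upwards [hind.ae_indepCentered_condLaw hX hU hint hmean hK] with ω hω
  by_cases hgood : X ω ∈ G ∧ ∀ l s, |h (X ω) l s| ≤ C
  · rw [← ofReal_measureReal]
    have hnoise := ((hω hgood.1).precomp ha).measureReal_le_abs_pseudoMaxDist_sub_le hq hgood.2
      hKC hKK ht hy hxB
    exact ENNReal.ofReal_le_ofReal ((measureReal_mono fun z hz => hz.2.2).trans hnoise)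
  · have hempty : Prod.mk (X ω) ⁻¹' T = ∅ :=
      Set.eq_empty_of_forall_notMem fun z hz => hgood ⟨hz.1, hz.2.1⟩
    simp [hempty]

/-- The value `f x` is not a measurable function of the pair `(x, f)` for the product `σ`-field;
on the continuous functions it is a limit of values at countably many points. -/
theorem exists_measurable_eval {E : Type*} [PseudoEMetricSpace E] [MeasurableSpace E]
    [OpensMeasurableSpace E] [SecondCountableTopology E] {A : Set E} (hA : A.Nonempty) :
    ∃ e : E × (E → ℝ) → ℝ, Measurable e ∧
      ∀ x ∈ A, ∀ f : E → ℝ, ContinuousOn f A → e (x, f) = f x := by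
  obtain ⟨x₀, hx₀⟩ := hA
  set φ : ℕ → SimpleFunc (E × (E → ℝ)) E :=
    fun k => SimpleFunc.approxOn Prod.fst measurable_fst A x₀ hx₀ k
  have hφ : ∀ k, Measurable fun b : E × (E → ℝ) => b.2 (φ k b) := fun k =>
    (φ k).measurable_bind (fun v b => b.2 v) fun v => (measurable_pi_apply v).comp measurable_snd
  refine ⟨fun b => limUnder atTop fun k => b.2 (φ k b),
    (StronglyMeasurable.limUnder fun k => (hφ k).stronglyMeasurable).measurable,
    fun x hx f hf => Tendsto.limUnder_eq ?_⟩
  have hlim : Tendsto (fun k => φ k (x, f)) atTop (𝓝[A] x) :=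
    tendsto_nhdsWithin_iff.2 ⟨SimpleFunc.tendsto_approxOn measurable_fst hx₀ (subset_closure hx),
      Eventually.of_forall fun k => SimpleFunc.approxOn_mem measurable_fst hx₀ k _⟩
  exact (hf x hx).tendsto.comp hlim

theorem exists_le_of_le_abs_iSup {κ : Type*} [Finite κ] {f : κ → ℝ} (hf : ∀ k, 0 ≤ f k)
    (hB : 0 < B) (h : B ≤ |⨆ k, f k|) : ∃ k, B ≤ f k := by
  rw [abs_of_nonneg (Real.iSup_nonneg hf)] at h
  cases isEmpty_or_nonempty κ
  · rw [Real.iSup_of_isEmpty] at h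
    exact absurd h (not_le.2 hB)
  · obtain ⟨k, hk⟩ := exists_eq_ciSup_of_finite (f := f)
    exact ⟨k, hk ▸ h⟩

end Denoising

/-! ### The noise of the factor model -/

namespace FactorModel

variable {Ω : Type*} [MeasurableSpace Ω] {r : ℕ} (M : FactorModel Ω r) {μ : Measure Ω}
  {A : Set (EuclideanSpace ℝ (Fin r))} {m : ℕ} {ν C : ℝ} {n : ℕ} {ω : Ω}

/-- The latent variables and the latent functions of sample `n`, as one random element: the
variable on which the errors are conditioned. -/
def latent (n : ℕ) (ω : Ω) :
    (Fin n → EuclideanSpace ℝ (Fin r)) × (Fin (M.p n) → EuclideanSpace ℝ (Fin r) → ℝ) :=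
  (fun i => M.α n i ω, fun l x => M.η n l ω x)

theorem measurable_latent (n : ℕ) : Measurable (M.latent n) :=
  (measurable_pi_lambda _ fun i => M.measurable_α n i).prodMk
    (measurable_pi_lambda _ fun l => measurable_pi_lambda _ fun x => M.measurable_η n l x)

theorem comap_latent (n : ℕ) : MeasurableSpace.comap (M.latent n) inferInstance = M.F n := by
  change MeasurableSpace.comap (fun ω => ((fun i => M.α n i ω), fun l x => M.η n l ω x))
    (MeasurableSpace.prod MeasurableSpace.pi MeasurableSpace.pi) = _
  rw [MeasurableSpace.comap_prodMk]
  simp only [MeasurableSpace.pi, MeasurableSpace.comap_iSup, MeasurableSpace.comap_comp]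
  rfl

theorem card_R (n : ℕ) : (Fintype.card (M.R n) : ℝ) = M.pR n := by
  rw [Fintype.card_coe, pR]

theorem pR_le (n : ℕ) : M.pR n ≤ M.p n := by
  rw [pR]
  exact_mod_cast (Finset.card_le_univ (M.R n)).trans_eq (Fintype.card_fin _)

variable {M}

theorem exists_pos_eventually_p_le (hp : (fun n => (M.p n : ℝ)) =O[atTop] fun n => M.pR n) :
    ∃ c > 0, ∀ᶠ n in atTop, (M.p n : ℝ) ≤ c * M.pR n := by
  obtain ⟨c, hc, hbound⟩ := hp.exists_pos
  refine ⟨c, hc, ?_⟩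
  filter_upwards [hbound.bound] with n hn
  simpa [pR] using hn

namespace Regularity

theorem condIndepFamily_comap_latent (hreg : M.Regularity μ A m ν) (n : ℕ) :
    CondIndepFamily μ (MeasurableSpace.comap (M.latent n) inferInstance)
      fun k : Fin n × Fin (M.p n) => M.u n k.1 k.2 := by
  rw [comap_latent]
  exact hreg.condIndep n

theorem condExp_comap_latent_ae_eq_zero (hreg : M.Regularity μ A m ν) (n : ℕ)
    (k : Fin n × Fin (M.p n)) :
    μ[M.u n k.1 k.2 | MeasurableSpace.comap (M.latent n) inferInstance] =ᵐ[μ] 0 := by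
  rw [comap_latent]
  exact hreg.condMean n k.1 k.2

theorem ae_mem (hreg : M.Regularity μ A m ν) (n : ℕ) : ∀ᵐ ω ∂μ, ∀ i, M.α n i ω ∈ A := by
  obtain ⟨c, C, -, hdensity⟩ := hreg.density
  obtain ⟨f, -, -, hmap⟩ := hdensity n
  refine ae_all_iff.2 fun i => ae_of_ae_map (M.measurable_α n i).aemeasurable ?_
  rw [hmap i]
  exact (withDensity_absolutelyContinuous _ _).ae_le
    (ae_restrict_mem hreg.isCompact.isClosed.measurableSet)

theorem exists_boundedC2On (hreg : M.Regularity μ A m ν) :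
    ∃ C : ℝ, 0 ≤ C ∧ ∀ n, ∀ᵐ ω ∂μ, ∀ l, BoundedC2On A C (M.η n l ω) := by
  obtain ⟨C, hC⟩ := hreg.smooth
  refine ⟨max C 0, le_max_right _ _, fun n => ?_⟩
  filter_upwards [hC n] with ω hω l
  exact ⟨(hω l).1.of_le (by exact_mod_cast hreg.two_le),
    fun k hk x hx => ((hω l).2 k (hk.trans hreg.two_le) x hx).trans (le_max_left _ _)⟩

variable [IsProbabilityMeasure μ]

theorem interior_nonempty (hreg : M.Regularity μ A m ν) : (interior A).Nonempty := by
  by_contra h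
  rw [Set.not_nonempty_iff_eq_empty] at h
  obtain ⟨c, C, -, hdensity⟩ := hreg.density
  obtain ⟨f, -, -, hmap⟩ := hdensity 1
  have hfrontier : A ⊆ frontier A := by
    rw [frontier, h, Set.sdiff_empty]
    exact subset_closure
  have hvolume : volume A = 0 :=
    measure_mono_null hfrontier (hreg.convex.addHaar_frontier volume)
  have hzero := hmap 0
  rw [Measure.restrict_eq_zero.2 hvolume, withDensity_zero_left] at hzero
  have := Measure.isProbabilityMeasure_map (μ := μ) (M.measurable_α 1 0).aemeasurable
  exact IsProbabilityMeasure.ne_zero _ hzero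

theorem uniqueDiffOn (hreg : M.Regularity μ A m ν) : UniqueDiffOn ℝ A :=
  uniqueDiffOn_convex hreg.convex hreg.interior_nonempty

theorem exists_measure_notMem_momentSet_le (hreg : M.Regularity μ A m ν) {δ : ℝ≥0∞} (hδ : 0 < δ) :
    ∃ K : ℝ, 0 ≤ K ∧ ∀ n, μ {ω | M.latent n ω ∉
      momentSet μ (M.latent n) (fun k : Fin n × Fin (M.p n) => M.u n k.1 k.2) (2 + ν) K} ≤ δ := by
  set S : Ω → ℝ≥0∞ := fun ω => ⨆ n, ⨆ i, ⨆ l,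
    condLExp (M.F n) μ (fun ω' => ENNReal.ofReal (|M.u n i l ω'| ^ (2 + ν))) ω
  have hS : Measurable S := .iSup fun n => .iSup fun i => .iSup fun l =>
    (measurable_condLExp (M.F n) μ _).mono (M.F_le n) le_rfl
  obtain ⟨K, hK⟩ :=
    ((tendsto_measure_natCast_lt hS hreg.moment).eventually_le_const hδ).exists
  refine ⟨K, Nat.cast_nonneg K, fun n => (measure_mono_ae ?_).trans hK⟩
  have hcond := fun k : Fin n × Fin (M.p n) => ae_lintegral_condLaw_eq_condLExp (μ := μ)
    (M.measurable_latent n) (U := fun k : Fin n × Fin (M.p n) => M.u n k.1 k.2)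
    (fun k => M.measurable_u n k.1 k.2) k (f := fun x => ENNReal.ofReal (|x| ^ (2 + ν)))
    (by fun_prop)
  filter_upwards [ae_all_iff.2 hcond] with ω hω hmem
  simp only [momentSet, Set.mem_ofPred_eq, not_forall, not_le] at hmem
  obtain ⟨k, hk⟩ := hmem
  rw [hω k, comap_latent, ENNReal.ofReal_natCast] at hk
  exact hk.trans_le (le_iSup_of_le n (le_iSup_of_le k.1 (le_iSup_of_le k.2 le_rfl)))

theorem measure_le_abs_iSup_pseudoMaxDist_sub_le (hreg : M.Regularity μ A m ν)
    (hη : ∀ᵐ ω ∂μ, ∀ l, BoundedC2On A C (M.η n l ω)) {K K' t y x B : ℝ} (hK : 0 ≤ K)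
    (hKC : K * C ^ (2 + ν) ≤ K') (hKK : K * K ≤ K') (ht : 0 < t) (hy : 0 < y) (hB : 0 < B)
    (hxB : 6 * x < B * M.pR n) :
    μ {ω | B ≤ |(⨆ a : Fin n × Fin n, |pseudoMaxDist n (M.R n) (M.X n ω) a.1 a.2 -
      pseudoMaxDist n (M.R n) (M.H n ω) a.1 a.2 - 0|)|} ≤
      μ {ω | M.latent n ω ∉ momentSet μ (M.latent n)
        (fun k : Fin n × Fin (M.p n) => M.u n k.1 k.2) (2 + ν) K} +
      ENNReal.ofReal (4 * ((n : ℝ) ^ 2 * fukNagaevBound (2 + ν) K' (M.p n) t y x)) := by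
  have hν := hreg.ν_pos
  obtain ⟨e, he, heval⟩ :=
    exists_measurable_eval (hreg.interior_nonempty.mono interior_subset)
  have hnoise := (hreg.condIndepFamily_comap_latent n).measure_le_abs_pseudoMaxDist_sub_le
    (h := fun b l => WithLp.toLp 2 fun s : M.R n => e (b.1 l, b.2 s))
    (a := fun ls => (ls.1, (ls.2 : Fin (M.p n)))) (q := 2 + ν) (B := B) (x := x)
    (M.measurable_latent n) (fun k => M.measurable_u n k.1 k.2)
    (fun k => hreg.integrable_u n k.1 k.2) (hreg.condExp_comap_latent_ae_eq_zero n) hK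
    (fun l => by fun_prop) (Function.injective_id.prodMap Subtype.val_injective) (by linarith)
    hKC hKK ht hy (by rwa [M.card_R])
  have hmono : fukNagaevBound (2 + ν) K' (Fintype.card (M.R n)) t y x ≤
      fukNagaevBound (2 + ν) K' (M.p n) t y x :=
    fukNagaevBound_mono_card ((mul_nonneg hK hK).trans hKK) (by rw [M.card_R]; exact M.pR_le n)
      hy.le
  refine (measure_mono_ae ?_).trans ((measure_union_le _ _).trans
    (add_le_add le_rfl (hnoise.trans (ENNReal.ofReal_le_ofReal (by gcongr)))))
  filter_upwards [hreg.ae_mem n, hη] with ω hα hη hω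
  obtain ⟨a, ha⟩ := exists_le_of_le_abs_iSup (fun _ => abs_nonneg _) hB hω
  have hval : ∀ l (s : M.R n), e ((M.latent n ω).1 l, (M.latent n ω).2 s) = M.H n ω l s :=
    fun l s => heval _ (hα l) _ (hη s).contDiffOn.continuousOn
  refine or_iff_not_imp_left.2 fun hmem => ⟨not_not.1 hmem, fun l s => ?_, a.1, a.2, ?_⟩
  · exact (congrArg abs (hval l s)).trans_le ((hη s).norm_le (hα l))
  · simp only [hval]
    rwa [sub_zero] at ha

theorem stochLE_denoising (hreg : M.Regularity μ A m ν)
    (hp : (fun n => (M.p n : ℝ)) =O[atTop] fun n => M.pR n)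
    (hrate : (fun n : ℕ => (n : ℝ) ^ (4 / ν) * Real.log n ^ ((ν - 2) / ν) / (M.p n : ℝ))
      =O[atTop] fun _ => (1 : ℝ)) :
    StochLE μ (fun n ω => ⨆ a : Fin n × Fin n,
      |pseudoMaxDist n (M.R n) (M.X n ω) a.1 a.2 -
        pseudoMaxDist n (M.R n) (M.H n ω) a.1 a.2 - 0|)
      fun n _ => √(Real.log n / (M.p n : ℝ)) := by
  have hpos : ∀ n, (0 : ℝ) < M.p n := fun n => by exact_mod_cast M.p_pos n
  obtain ⟨C, hC, hη⟩ := hreg.exists_boundedC2On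
  obtain ⟨c, hc, hpc⟩ := exists_pos_eventually_p_le hp
  refine .of_forall_eventually_le fun δ hδ => ?_
  obtain ⟨K, hK, hmoment⟩ := hreg.exists_measure_notMem_momentSet_le (ENNReal.half_pos hδ.ne')
  set K' := K * C ^ (2 + ν) + K * K
  have hK' : 0 ≤ K' := by positivity
  set b := Real.exp (2 + ν) * (1 + K') + 3
  have : 0 < b := by positivity
  have htail := ENNReal.tendsto_ofReal
    ((tendsto_sq_mul_fukNagaevBound hreg.ν_pos hpos hrate hK' le_rfl).const_mul 4)
  rw [mul_zero, ENNReal.ofReal_zero] at htail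
  filter_upwards [eventually_gt_atTop (6 * b * c)] with ε hε
  have hε0 : 0 < ε := lt_of_le_of_lt (by positivity) hε
  filter_upwards [htail.eventually_le_const (ENNReal.half_pos hδ.ne'), hpc,
    eventually_ge_atTop 2] with n htail hpc hn
  have hlog : 0 < Real.log n := Real.log_pos (by exact_mod_cast hn)
  have hp0 := hpos n
  have hpR : 0 < M.pR n := pos_of_mul_pos_right (hp0.trans_le hpc) hc.le
  rw [← ENNReal.add_halves δ]
  refine (hreg.measure_le_abs_iSup_pseudoMaxDist_sub_le (hη n) hK
    (le_add_of_nonneg_right (mul_nonneg hK hK)) (le_add_of_nonneg_left (by positivity))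
    (t := √(Real.log n / M.p n)) (y := √(M.p n * Real.log n)) (x := b * √(M.p n * Real.log n))
    (by positivity) (by positivity) (by positivity) ?_).trans (add_le_add (hmoment n) htail)
  rw [← mul_sqrt_div_eq_sqrt_mul hp0, abs_of_nonneg (Real.sqrt_nonneg _)]
  calc 6 * (b * (M.p n * √(Real.log n / M.p n)))
      ≤ 6 * (b * (c * M.pR n * √(Real.log n / M.p n))) := by gcongr
    _ = 6 * b * c * √(Real.log n / M.p n) * M.pR n := by ring
    _ < ε * √(Real.log n / M.p n) * M.pR n := by gcongr

end Regularity

end FactorModel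

/-! ### The latent surface of the factor model -/

theorem min_div_le_iInf_div_norm_sub {κ E : Type*} [NormedAddCommGroup E] {x : κ → E}
    {d : κ → κ → ℝ} {b s Δ D : ℝ} (hne : ∃ i j, x i ≠ x j) (hΔ : 0 ≤ Δ) (hD : 0 < D)
    (hdiam : ∀ i j, ‖x i - x j‖ ≤ D)
    (hnear : ∀ i j, ‖x i - x j‖ ≤ s → b * ‖x i - x j‖ ≤ d i j)
    (hfar : ∀ i j, s < ‖x i - x j‖ → Δ ≤ d i j) :
    min b (Δ / D) ≤ ⨅ a : {a : κ × κ // x a.1 ≠ x a.2}, d a.1.1 a.1.2 / ‖x a.1.1 - x a.1.2‖ := by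
  obtain ⟨i₀, j₀, hne⟩ := hne
  have : Nonempty {a : κ × κ // x a.1 ≠ x a.2} := ⟨⟨(i₀, j₀), hne⟩⟩
  refine le_ciInf fun ⟨⟨i, j⟩, hij⟩ => ?_
  rw [le_div_iff₀ (norm_pos_iff.2 (sub_ne_zero.2 hij))]
  rcases le_or_gt ‖x i - x j‖ s with hle | hgt
  · calc min b (Δ / D) * ‖x i - x j‖ ≤ b * ‖x i - x j‖ := by
          gcongr
          exact min_le_left _ _
      _ ≤ d i j := hnear i j hle
  · calc min b (Δ / D) * ‖x i - x j‖ ≤ Δ / D * D := by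
          gcongr
          · exact min_le_right _ _
          · exact hdiam i j
      _ = Δ := div_mul_cancel₀ Δ hD.ne'
      _ ≤ d i j := hfar i j hgt

namespace FactorModel

variable {Ω : Type*} [MeasurableSpace Ω] {r : ℕ} (M : FactorModel Ω r) {μ : Measure Ω}
  {A : Set (EuclideanSpace ℝ (Fin r))} {m : ℕ} {ν c C κ : ℝ} {n : ℕ} {ω : Ω}
  {x : EuclideanSpace ℝ (Fin r)}

/-- The latent functions with index in `R n` as a vector-valued function on the latent space, scaled
so that its inner products are averages over the `pR n` features, hence of order one. -/
noncomputable def surface (n : ℕ) (ω : Ω) : EuclideanSpace ℝ (Fin r) → EuclideanSpace ℝ (M.R n) :=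
  (√(M.pR n))⁻¹ • M.etaR n ω

theorem abs_inner_H_sub_div_card (i j l : Fin n) :
    |inner ℝ (M.H n ω i - M.H n ω j) (M.H n ω l)| / Fintype.card (M.R n) =
      |inner ℝ (M.surface n ω (M.α n i ω) - M.surface n ω (M.α n j ω))
        (M.surface n ω (M.α n l ω))| := by
  have hpR : 0 ≤ M.pR n := Nat.cast_nonneg _
  simp only [surface, Pi.smul_apply, ← smul_sub, real_inner_smul_left, real_inner_smul_right, H]
  rw [← mul_assoc, ← mul_inv, Real.mul_self_sqrt hpR, abs_mul, abs_inv, abs_of_nonneg hpR,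
    card_R, div_eq_inv_mul]

variable {M}

theorem boundedC2On_surface (hC : 0 ≤ C) (hA : UniqueDiffOn ℝ A)
    (hη : ∀ l, BoundedC2On A C (M.η n l ω)) : BoundedC2On A C (M.surface n ω) := by
  have heta : BoundedC2On A (C * √(M.pR n)) (M.etaR n ω) := by
    rw [← M.card_R]
    exact .euclidean hC hA fun l => hη l
  refine (heta.const_smul hA (√(M.pR n))⁻¹).mono ?_
  rw [abs_of_nonneg (inv_nonneg.2 (Real.sqrt_nonneg _)), mul_left_comm]
  exact mul_le_of_le_one_right hC (inv_mul_le_one (a := √(M.pR n)))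

theorem fderivWithin_etaR_apply (hA : UniqueDiffWithinAt ℝ A x)
    (hη : ∀ l, DifferentiableWithinAt ℝ (M.η n l ω) A x) (v : EuclideanSpace ℝ (Fin r)) :
    fderivWithin ℝ (M.etaR n ω) A x v = Matrix.toEuclideanLin (M.jacobian A n ω x) v := by
  have heta : DifferentiableWithinAt ℝ (M.etaR n ω) A x :=
    differentiableWithinAt_euclidean.2 fun l => hη l
  ext l
  have hcoord := (hasFDerivWithinAt_euclidean.1 heta.hasFDerivWithinAt l).fderivWithin hA
  have hexpand : v = ∑ j, v j • EuclideanSpace.single j (1 : ℝ) := by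
    simpa using ((EuclideanSpace.basisFun (Fin r) ℝ).sum_repr v).symm
  calc fderivWithin ℝ (M.etaR n ω) A x v l = fderivWithin ℝ (M.η n l ω) A x v :=
        (congrArg (fun L => L v) hcoord).symm
    _ = ∑ j, v j * fderivWithin ℝ (M.η n l ω) A x (EuclideanSpace.single j 1) := by
        conv_lhs => rw [hexpand, map_sum]
        simp only [map_smul, smul_eq_mul]
    _ = Matrix.toEuclideanLin (M.jacobian A n ω x) v l := by
        simp [Matrix.toLpLin_apply, Matrix.mulVec, dotProduct, jacobian, mul_comm]

theorem mul_sq_norm_le_sq_norm_fderivWithin_surface (hA : UniqueDiffWithinAt ℝ A x)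
    (hη : ∀ l, DifferentiableWithinAt ℝ (M.η n l ω) A x)
    (hc : c ≤ sMin ((1 / M.pR n) • ((M.jacobian A n ω x).transpose * M.jacobian A n ω x)))
    (v : EuclideanSpace ℝ (Fin r)) :
    c * ‖v‖ ^ 2 ≤ ‖fderivWithin ℝ (M.surface n ω) A x v‖ ^ 2 := by
  set J := M.jacobian A n ω x
  have hpR : 0 ≤ M.pR n := Nat.cast_nonneg _
  have hgram : ((1 / M.pR n) • (J.transpose * J)).PosSemidef := by
    rw [← Matrix.conjTranspose_eq_transpose_of_trivial]
    exact (Matrix.posSemidef_conjTranspose_mul_self J).smul (by positivity)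
  calc c * ‖v‖ ^ 2 ≤ sMin ((1 / M.pR n) • (J.transpose * J)) * ‖v‖ ^ 2 := by gcongr
    _ ≤ inner ℝ (Matrix.toEuclideanLin ((1 / M.pR n) • (J.transpose * J)) v) v :=
        sMin_mul_sq_norm_le_inner hgram v
    _ = (1 / M.pR n) * ‖Matrix.toEuclideanLin J v‖ ^ 2 := by
        rw [map_smul, LinearMap.smul_apply, real_inner_smul_left,
          inner_toEuclideanLin_transpose_mul_self]
    _ = ‖fderivWithin ℝ (M.surface n ω) A x v‖ ^ 2 := by
        rw [surface, fderivWithin_const_smul_field _ hA, smul_apply,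
          fderivWithin_etaR_apply hA hη, norm_smul, mul_pow, Real.norm_eq_abs, sq_abs, inv_pow,
          Real.sq_sqrt hpR, one_div]

namespace Regularity

variable [IsProbabilityMeasure μ]

theorem stochLE_upper (hreg : M.Regularity μ A m ν) :
    StochLE μ (fun n ω => ⨆ a : {a : Fin n × Fin n // M.α n a.1 ω ≠ M.α n a.2 ω},
      pseudoMaxDist n (M.R n) (M.H n ω) a.1.1 a.1.2 /
        ‖M.α n a.1.1 ω - M.α n a.1.2 ω‖ ^ (1 : ℝ)) fun _ _ => 1 := by
  obtain ⟨C, hC, hη⟩ := hreg.exists_boundedC2On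
  refine .one_right_of_ae_abs_le (C := C * C) fun n => ?_
  filter_upwards [hreg.ae_mem n, hη n] with ω hα hη
  have hsurf := boundedC2On_surface hC hreg.uniqueDiffOn hη
  rw [abs_of_nonneg (Real.iSup_nonneg fun a => by
    have := pseudoMaxDist_nonneg (M.H n ω) a.1.1 a.1.2
    positivity)]
  refine Real.iSup_le (fun ⟨⟨i, j⟩, _⟩ => ?_) (by positivity)
  rw [Real.rpow_one]
  refine div_le_of_le_mul₀ (norm_nonneg _) (by positivity)
    (pseudoMaxDist_le (by positivity) fun l _ _ => ?_)
  rw [M.abs_inner_H_sub_div_card]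
  calc |inner ℝ (M.surface n ω (M.α n i ω) - M.surface n ω (M.α n j ω))
        (M.surface n ω (M.α n l ω))|
      ≤ ‖M.surface n ω (M.α n i ω) - M.surface n ω (M.α n j ω)‖ *
          ‖M.surface n ω (M.α n l ω)‖ := abs_real_inner_le_norm _ _
    _ ≤ C * ‖M.α n i ω - M.α n j ω‖ * C := by
        gcongr
        · exact hsurf.norm_sub_le hreg.uniqueDiffOn hreg.convex (hα j) (hα i)
        · exact hsurf.norm_le (hα l)
    _ = C * C * ‖M.α n i ω - M.α n j ω‖ := by ring

theorem exists_le_measure_preimage_ball (hreg : M.Regularity μ A m ν)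
    {w : EuclideanSpace ℝ (Fin r)} (hw : w ∈ A) (hκ : 0 < κ) :
    ∃ θ > 0, ∀ n i, θ ≤ μ.real (M.α n i ⁻¹' Metric.ball w κ) := by
  obtain ⟨c, C, hc, hdensity⟩ := hreg.density
  have hA : MeasurableSet A := hreg.isCompact.isClosed.measurableSet
  have hclosure : w ∈ closure (interior A) := by
    rw [hreg.convex.closure_interior_eq_closure_of_nonempty_interior hreg.interior_nonempty]
    exact subset_closure hw
  have hinter : (Metric.ball w κ ∩ interior A).Nonempty :=
    mem_closure_iff_nhds.1 hclosure _ (Metric.ball_mem_nhds w hκ)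
  have hpos : 0 < volume (Metric.ball w κ ∩ A) :=
    ((Metric.isOpen_ball.inter isOpen_interior).measure_pos volume hinter).trans_le
      (measure_mono (Set.inter_subset_inter_right _ interior_subset))
  have hfin : volume (Metric.ball w κ ∩ A) ≠ ∞ :=
    measure_ne_top_of_subset Set.inter_subset_right hreg.isCompact.measure_lt_top.ne
  refine ⟨c * volume.real (Metric.ball w κ ∩ A), mul_pos hc (ENNReal.toReal_pos hpos.ne' hfin),
    fun n i => ?_⟩
  obtain ⟨f, -, hf, hmap⟩ := hdensity n
  have hle : ENNReal.ofReal c * volume (Metric.ball w κ ∩ A) ≤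
      μ (M.α n i ⁻¹' Metric.ball w κ) := by
    rw [← Measure.map_apply (M.measurable_α n i) measurableSet_ball, hmap i,
      withDensity_apply _ measurableSet_ball, Measure.restrict_restrict measurableSet_ball,
      ← setLIntegral_const]
    exact setLIntegral_mono' (measurableSet_ball.inter hA) fun x hx =>
      ENNReal.ofReal_le_ofReal (hf x hx.2).1
  have hreal := ENNReal.toReal_mono (measure_ne_top _ _) hle
  rwa [ENNReal.toReal_mul, ENNReal.toReal_ofReal hc.le] at hreal

theorem probTendsToOne_forall_mem_exists_norm_sub_le (hreg : M.Regularity μ A m ν) (hκ : 0 < κ) :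
    ProbTendsToOne μ fun n => {ω | ∀ z ∈ A, ∀ i j, ∃ l, l ≠ i ∧ l ≠ j ∧ ‖M.α n l ω - z‖ ≤ κ} := by
  obtain ⟨T, hTA, hT, hcover⟩ := hreg.isCompact.finite_cover_balls (half_pos hκ)
  have hball : ∀ w ∈ hT.toFinset, ProbTendsToOne μ fun n =>
      {ω | ∀ i j, ∃ l, l ≠ i ∧ l ≠ j ∧ M.α n l ω ∈ Metric.ball w (κ / 2)} := by
    intro w hw
    obtain ⟨θ, hθ0, hθ⟩ :=
      hreg.exists_le_measure_preimage_ball (hTA (hT.mem_toFinset.1 hw)) (half_pos hκ)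
    exact probTendsToOne_exists_ne_ne_mem hreg.indep M.measurable_α measurableSet_ball hθ0 hθ
  refine (ProbTendsToOne.biInter_finset hball).mono_ae
    (.of_forall fun n => .of_forall fun ω hω z hz i j => ?_)
  obtain ⟨w, hw, hzw⟩ := Set.mem_iUnion₂.1 (hcover hz)
  obtain ⟨l, hi, hj, hl⟩ := Set.mem_iInter₂.1 hω w (hT.mem_toFinset.2 hw) i j
  refine ⟨l, hi, hj, ?_⟩
  rw [← dist_eq_norm]
  calc dist (M.α n l ω) z ≤ dist (M.α n l ω) w + dist z w := dist_triangle_right _ _ _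
    _ ≤ κ / 2 + κ / 2 := add_le_add (Metric.mem_ball.1 hl).le (Metric.mem_ball.1 hzw).le
    _ = κ := add_halves κ

theorem exists_ne_mem (hreg : M.Regularity μ A m ν) (hr : 0 < r) : ∃ x ∈ A, ∃ y ∈ A, x ≠ y := by
  have : Nonempty (Fin r) := ⟨⟨0, hr⟩⟩
  obtain ⟨x, hx⟩ := hreg.interior_nonempty
  obtain ⟨y, hyx, hy⟩ : ({x}ᶜ ∩ interior A).Nonempty :=
    (dense_compl_singleton x).inter_open_nonempty _ isOpen_interior ⟨x, hx⟩ |>.mono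
      (Set.inter_comm _ _).subset
  exact ⟨x, interior_subset hx, y, interior_subset hy, Ne.symm hyx⟩

theorem probTendsToOne_exists_ne (hreg : M.Regularity μ A m ν) (hr : 0 < r) :
    ProbTendsToOne μ fun n => {ω | ∃ i j, M.α n i ω ≠ M.α n j ω} := by
  obtain ⟨x, hx, y, hy, hxy⟩ := hreg.exists_ne_mem hr
  have hdist : 0 < dist x y := dist_pos.2 hxy
  refine (hreg.probTendsToOne_forall_mem_exists_norm_sub_le
    (κ := dist x y / 3) (by positivity)).mono_ae ?_
  filter_upwards [eventually_gt_atTop 0] with n hn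
  refine .of_forall fun ω hω => ?_
  obtain ⟨i, -, -, hi⟩ := hω x hx ⟨0, hn⟩ ⟨0, hn⟩
  obtain ⟨j, -, -, hj⟩ := hω y hy ⟨0, hn⟩ ⟨0, hn⟩
  refine ⟨i, j, fun hij => ?_⟩
  rw [← dist_eq_norm] at hi hj
  rw [hij] at hi
  linarith [dist_triangle_left x y (M.α n j ω)]

theorem exists_probTendsToOne_mul_norm_le_pseudoMaxDist (hreg : M.Regularity μ A m ν)
    (hjac : M.JacobianNondegenerate μ A) :
    ∃ κ > 0, ∃ b > 0, ProbTendsToOne μ fun n => {ω | ∀ i j, ‖M.α n i ω - M.α n j ω‖ ≤ κ →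
      b * ‖M.α n i ω - M.α n j ω‖ ≤ pseudoMaxDist n (M.R n) (M.H n ω) i j} := by
  obtain ⟨C, hC, hη⟩ := hreg.exists_boundedC2On
  obtain ⟨c, hc, hjac⟩ := hjac
  obtain ⟨κ, hκ, b, hb, hlocal⟩ := exists_forall_le_abs_inner_sub hreg.isCompact.isBounded
    hreg.convex hreg.interior_nonempty C hc
  refine ⟨κ, hκ, b, hb, (hjac.inter
    (hreg.probTendsToOne_forall_mem_exists_norm_sub_le hκ)).mono_ae (.of_forall fun n => ?_)⟩
  filter_upwards [hreg.ae_mem n, hη n] with ω hα hη ⟨hjac, hdense⟩ i j hij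
  obtain ⟨z, hz, hinner⟩ := hlocal _ (M.surface n ω) (boundedC2On_surface hC hreg.uniqueDiffOn hη)
    (M.α n j ω) (hα j)
    (mul_sq_norm_le_sq_norm_fderivWithin_surface (hreg.uniqueDiffOn _ (hα j))
      (fun l => (hη l).differentiableOn _ (hα j)) (hjac j))
    (M.α n i ω) (hα i) hij
  obtain ⟨l, hi, hj, hl⟩ := hdense z hz i j
  calc b * ‖M.α n i ω - M.α n j ω‖
      ≤ |inner ℝ (M.surface n ω (M.α n i ω) - M.surface n ω (M.α n j ω))
          (M.surface n ω (M.α n l ω))| := hinner _ (hα l) hl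
    _ = |inner ℝ (M.H n ω i - M.H n ω j) (M.H n ω l)| / Fintype.card (M.R n) :=
        (M.abs_inner_H_sub_div_card i j l).symm
    _ ≤ pseudoMaxDist n (M.R n) (M.H n ω) i j := le_pseudoMaxDist (M.H n ω) hi hj

theorem stochLE_lower (hreg : M.Regularity μ A m ν) (hr : 0 < r)
    (hident : M.Identified μ pseudoMaxDist) (hjac : M.JacobianNondegenerate μ A) :
    StochLE μ (fun _ _ => 1) fun n ω => ⨅ a : {a : Fin n × Fin n // M.α n a.1 ω ≠ M.α n a.2 ω},
      pseudoMaxDist n (M.R n) (M.H n ω) a.1.1 a.1.2 /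
        ‖M.α n a.1.1 ω - M.α n a.1.2 ω‖ ^ (1 : ℝ) := by
  obtain ⟨κ, hκ, b, hb, hnear⟩ := hreg.exists_probTendsToOne_mul_norm_le_pseudoMaxDist hjac
  obtain ⟨D, hD, hnorm⟩ := hreg.isCompact.isBounded.exists_pos_norm_le
  simp only [Real.rpow_one]
  refine .one_left_of_forall_exists_measure_lt_le fun δ hδ => ?_
  have hδ2 : 0 < δ / 2 := ENNReal.half_pos hδ.ne'
  obtain ⟨Δ, hlimsup, hΔ : 0 < Δ⟩ :=
    (((hident κ hκ).eventually_lt_const hδ2).and self_mem_nhdsWithin).exists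
  refine ⟨min b (Δ / (D + D)), lt_min hb (by positivity), ?_⟩
  filter_upwards [eventually_lt_of_limsup_lt hlimsup,
    (hnear.inter (hreg.probTendsToOne_exists_ne hr)).eventually_le_const hδ2] with n hfar hgood
  rw [← ENNReal.add_halves δ]
  refine (measure_mono_ae ?_).trans ((measure_union_le _ _).trans (add_le_add hfar.le hgood))
  filter_upwards [hreg.ae_mem n] with ω hα hω
  refine or_iff_not_imp_left.2 fun hfar ⟨hnear, hne⟩ => hω.not_ge ?_
  refine min_div_le_iInf_div_norm_sub (d := pseudoMaxDist n (M.R n) (M.H n ω)) hne hΔ.le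
    (by positivity) (fun i j => ?_) hnear fun i j hij => ?_
  · exact norm_sub_le_of_le (hnorm _ (hα i)) (hnorm _ (hα j))
  · exact not_lt.1 fun hlt => hfar ⟨i, j, hlt, hij⟩

end Regularity

end FactorModel

theorem mainTheorem5_general {Ω : Type*} [MeasurableSpace Ω] (μ : Measure Ω)
    [IsProbabilityMeasure μ] {r : ℕ} (hr : 0 < r) (M : FactorModel Ω r)
    (A : Set (EuclideanSpace ℝ (Fin r))) (m : ℕ) (ν : ℝ)
    (hreg : M.Regularity μ A m ν)
    (hp : (fun n => (M.p n : ℝ)) =O[atTop] fun n => M.pR n)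
    (hident : M.Identified μ pseudoMaxDist)
    (hjac : M.JacobianNondegenerate μ A)
    (hrate : (fun n : ℕ => (n : ℝ) ^ (4 / ν) * Real.log n ^ ((ν - 2) / ν) / (M.p n : ℝ))
      =O[atTop] fun _ => (1 : ℝ)) :
    M.IndirectMatching μ pseudoMaxDist (fun n => √(Real.log n / (M.p n : ℝ))) 0 1 1 where
  shift_nonneg := le_rfl
  lower_pos := one_pos
  upper_pos := one_pos
  a_pos := by
    filter_upwards [eventually_ge_atTop 2] with n hn
    have hp0 : (0 : ℝ) < M.p n := by exact_mod_cast M.p_pos n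
    have hlog : 0 < Real.log n := Real.log_pos (by exact_mod_cast hn)
    positivity
  a_tendsto := tendsto_sqrt_log_div hreg.ν_pos (fun n => by exact_mod_cast M.p_pos n) hrate
  denoising := hreg.stochLE_denoising hp hrate
  upper := hreg.stochLE_upper
  lower := hreg.stochLE_lower hr hident hjac

theorem mainTheorem5 {Ω : Type*} [MeasurableSpace Ω] (μ : Measure Ω) [IsProbabilityMeasure μ]
    {r : ℕ} (hr : 0 < r) (M : FactorModel Ω r) (A : Set (EuclideanSpace ℝ (Fin r)))
    (m : ℕ) (ν : ℝ)
    (hreg : M.Regularity μ A m ν)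
    (hsplit : (fun n => M.pR n) =Θ[atTop] (fun n => (M.p n : ℝ)))
    (hident : M.Identified μ pseudoMaxDist)
    (hjac : M.JacobianNondegenerate μ A)
    (hnc : M.NonCollapsing μ A)
    (hrate : (fun n : ℕ => (n : ℝ) ^ (4 / ν) * Real.log n ^ ((ν - 2) / ν) / (M.p n : ℝ))
      =O[atTop] (fun _ => (1 : ℝ))) :
    M.IndirectMatching μ pseudoMaxDist (fun n => Real.sqrt (Real.log n / (M.p n : ℝ))) 0 1 1 :=
  mainTheorem5_general μ hr M A m ν hreg hsplit.2 hident hjac hrate
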